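/- **Model.** A graph algorithm is a program for the randomized word RAM with words of $O(\log n)$ bits: finitely many registers, a memory of words (initially zero apart from the input numbers), and unit-cost instructions for constants, integer and bitwise arithmetic, direct and indirect memory access, branching, drawing a uniformly random element of $\{0,\dots,x\}$ where $x$ is the content of a register, and reading one entry of the adjacency matrix of the input graph. A run in which a value does not fit in a word counts as a failure. **Matrix multiplication.** Fix a field $F$. For real $a,b,c$ let $\omega(a,b,c)$ be the infimum of all $\tau$ such that the product of an $\lfloor n^a\rfloor\times\lfloor n^b\rfloor$ matrix and an $\lfloor n^b\rfloor\times\lfloor n^c\rfloor$ matrix over $F$ can be computed with $O(n^{\tau})$ arithmetic operations $+,-,\times$, and let $\mathrm{MM}(n^a,n^b,n^c)=n^{\omega(a,b,c)}$. **Hypothesis 1 (for $b\in[0,1]$).** Any randomized algorithm that decides, with probability at least $2/3$, whether a tripartite graph with parts $A,B,C$, $|A|=|C|=n$, $|B|=\lfloor n^b\rfloor$, contains a triangle needs $\mathrm{MM}(n,n^b,n)^{1-o(1)}$ time. That is: for no $\delta>0$ is there such an algorithm (given $n$, $|B|$ and the adjacency matrix, with the parts numbered consecutively) that gives the correct answer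 with probability at least $2/3$ within $O(\mathrm{MM}(n,n^b,n)^{1-\delta})$ steps on all such graphs with $n\ge 1$. **Theorem.** Let $b\in[0,1]$ and assume Hypothesis 1 for $b$. Let $0<\varepsilon<1$ and $\kappa>0$ be constants and put $t=t(n)=\kappa\, n^{1-b}$ (in particular $t=n^{1-b}$), so that $\mathrm{MM}(n,n/t,n)$ is, up to constant factors of the dimensions, $\mathrm{MM}(n,n^{b},n)=n^{\omega(1,b,1)}$. Then any randomized algorithm that $(1\pm\varepsilon)$-approximates the number of triangles of a graph needs $\mathrm{MM}(n,n/t,n)^{1-o(1)}$ time on $n$-vertex graphs with at least $t$ triangles. That is, for no $\delta>0$ is there a randomized word-RAM algorithm (given $n$ and the adjacency matrix) such that for every $n\ge1$ and every $n$-vertex graph $G$, with $t_G$ denoting its number of triangles, 1. if $t_G=0$, then with probability at least $2/3$ the algorithm halts, after some number of steps depending arbitrarily on $G$, with output $0$; 2. if $t_G\ge t(n)$, then with probability at least $2/3$ the algorithm halts within $O(\mathrm{MM}(n,n^{b},n)^{1-\delta})$ steps with a rational output $\hat t$ satisfying $(1-\varepsilon)t_G\le\hat t\le(1+\varepsilon)t_G$.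 (Nothing is required on graphs with $0<t_G<t(n)$.) -/

import Mathlib

/-! ### Rectangular matrix multiplication -/

/-- Division-free straight-line programs over a commutative ring `R`, listed with the most recent
result first. The elements of `S` (inputs and constants) are available for free; the length of the
list is the number of arithmetic operations. -/
inductive StraightLine {R : Type*} [CommRing R] (S : Set R) : List R → Prop
  | nil : StraightLine S []
  | add (l : List R) (x y : R) : StraightLine S l → (x ∈ S ∨ x ∈ l) → (y ∈ S ∨ y ∈ l) →
      StraightLine S ((x + y) :: l)
  | sub (l : List R) (x y : R) : StraightLine S l → (x ∈ S ∨ x ∈ l) → (y ∈ S ∨ y ∈ l) →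
      StraightLine S ((x - y) :: l)
  | mul (l : List R) (x y : R) : StraightLine S l → (x ∈ S ∨ x ∈ l) → (y ∈ S ∨ y ∈ l) →
      StraightLine S ((x * y) :: l)

/-- Polynomials in the entries of a generic `p × q` matrix and a generic `q × r` matrix. -/
abbrev MatMulRing (F : Type*) [Field F] (p q r : ℕ) : Type _ :=
  MvPolynomial ((Fin p × Fin q) ⊕ (Fin q × Fin r)) F

/-- What a program that multiplies two matrices may use for free: the entries of the two matrices
and the constants of the field. -/
def matMulInputs (F : Type*) [Field F] (p q r : ℕ) : Set (MatMulRing F p q r) :=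
  Set.range MvPolynomial.X ∪ Set.range MvPolynomial.C

/-- The `(i, k)` entry of the product of the two generic matrices. -/
noncomputable def matMulEntry (F : Type*) [Field F] (p q r : ℕ) (i : Fin p) (k : Fin r) :
    MatMulRing F p q r :=
  ∑ j : Fin q, MvPolynomial.X (Sum.inl (i, j)) * MvPolynomial.X (Sum.inr (j, k))

/-- The product of a `p × q` matrix and a `q × r` matrix over `F` can be computed with `L`
arithmetic operations. -/
def MatMulIn (F : Type*) [Field F] (p q r L : ℕ) : Prop :=
  ∃ l : List (MatMulRing F p q r), StraightLine (matMulInputs F p q r) l ∧ l.length ≤ L ∧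
    ∀ (i : Fin p) (k : Fin r),
      matMulEntry F p q r i k ∈ matMulInputs F p q r ∨ matMulEntry F p q r i k ∈ l

/-- `n ^ a` rounded down to an integer. -/
noncomputable def powDim (n : ℕ) (a : ℝ) : ℕ := ⌊(n : ℝ) ^ a⌋₊

/-- The exponent `ω(a, b, c)` of multiplying `n ^ a × n ^ b` by `n ^ b × n ^ c` matrices. -/
noncomputable def omegaExp (F : Type*) [Field F] (a b c : ℝ) : ℝ :=
  sInf {τ : ℝ | ∃ K : ℝ, ∀ n : ℕ, 1 ≤ n → ∃ L : ℕ, (L : ℝ) ≤ K * (n : ℝ) ^ τ ∧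
    MatMulIn F (powDim n a) (powDim n b) (powDim n c) L}

/-- `MM(n ^ a, n ^ b, n ^ c) = n ^ ω(a, b, c)`. -/
noncomputable def MM (F : Type*) [Field F] (n : ℕ) (a b c : ℝ) : ℝ :=
  (n : ℝ) ^ omegaExp F a b c

/-! ### The randomized word RAM -/

/-- Binary operations on words that take one step. -/
inductive WordOp
  | add | sub | mul | div | mod | and | or | xor | shl | shr

def WordOp.eval : WordOp → ℕ → ℕ → ℕ
  | .add, x, y => x + y
  | .sub, x, y => x - y
  | .mul, x, y => x * y
  | .div, x, y => x / y
  | .mod, x, y => x % y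
  | .and, x, y => x &&& y
  | .or, x, y => x ||| y
  | .xor, x, y => x ^^^ y
  | .shl, x, y => x <<< y
  | .shr, x, y => x >>> y

/-- Instructions; the final labels say where the computation continues. -/
inductive Instr (Reg Label : Type)
  /-- `r := v` for a fixed number `v` -/
  | lit (r : Reg) (v : ℕ) (next : Label)
  /-- `r := o(x, y)` -/
  | op (o : WordOp) (r x y : Reg) (next : Label)
  /-- `r := memory[x]` -/
  | load (r x : Reg) (next : Label)
  /-- `memory[x] := y` -/
  | store (x y : Reg) (next : Label)
  /-- `r :=` the adjacency matrix entry in row `x` and column `y` of the input graph -/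
  | query (r x y : Reg) (next : Label)
  /-- `r :=` a uniformly random element of `{0, …, x}`, independent of everything before -/
  | rand (r x : Reg) (next : Label)
  /-- go to `yes` if `x < y` and to `no` otherwise -/
  | branch (x y : Reg) (yes no : Label)
  | halt

/-- A program: finitely many registers and finitely many labelled instructions. -/
structure RAMProgram where
  Reg : Type
  Label : Type
  finite_reg : Finite Reg
  finite_label : Finite Label
  start : Label
  code : Label → Instr Reg Label

namespace RAMProgram

/-- Current label, contents of the registers, contents of the memory. -/
structure Config (P : RAMProgram) where
  pc : P.Label
  reg : P.Reg → ℕ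
  mem : ℕ → ℕ

variable (P : RAMProgram)

open Classical in
/-- Write `v` to the register `r` and continue at `next`. Words hold the numbers below `W`; a value
that does not fit makes the computation fail (`none`). -/
noncomputable def put (W : ℕ) (c : P.Config) (r : P.Reg) (v : ℕ) (next : P.Label) :
    Option P.Config :=
  if v < W then some { pc := next, reg := Function.update c.reg r v, mem := c.mem } else none

/-- One step of the machine with input matrix `adj`. A halted computation stays as it is. -/
noncomputable def step (adj : ℕ → ℕ → ℕ) (W : ℕ) (c : P.Config) : PMF (Option P.Config) :=
  match P.code c.pc with
  | .lit r v next => PMF.pure (P.put W c r v next)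
  | .op o r x y next => PMF.pure (P.put W c r (o.eval (c.reg x) (c.reg y)) next)
  | .load r x next => PMF.pure (P.put W c r (c.mem (c.reg x)) next)
  | .store x y next => PMF.pure
      (some { pc := next, reg := c.reg, mem := Function.update c.mem (c.reg x) (c.reg y) })
  | .query r x y next => PMF.pure (P.put W c r (adj (c.reg x) (c.reg y)) next)
  | .rand r x next =>
      (PMF.uniformOfFintype (Fin (c.reg x + 1))).map fun v => P.put W c r v next
  | .branch x y yes no => PMF.pure
      (some { pc := if c.reg x < c.reg y then yes else no, reg := c.reg, mem := c.mem })
  | .halt => PMF.pure (some c)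

/-- At the start the memory holds the given numbers in its first cells; all else is zero. -/
def init (input : List ℕ) : P.Config where
  pc := P.start
  reg := fun _ => 0
  mem := fun a => input.getD a 0

/-- The distribution of the machine's state after `k` steps (`none`: the computation has failed). -/
noncomputable def run (adj : ℕ → ℕ → ℕ) (W : ℕ) (input : List ℕ) : ℕ → PMF (Option P.Config)
  | 0 => PMF.pure (some (P.init input))
  | k + 1 => (run adj W input k).bind fun s =>
      match s with
      | none => PMF.pure none
      | some c => P.step adj W c

/-- The probability that the computation has halted after at most `k` steps, without an overflow,
with a memory that satisfies `good`. -/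
noncomputable def successProb (adj : ℕ → ℕ → ℕ) (W : ℕ) (input : List ℕ) (k : ℕ)
    (good : (ℕ → ℕ) → Prop) : ENNReal :=
  (P.run adj W input k).toOuterMeasure
    {s | ∃ c : P.Config, s = some c ∧ P.code c.pc = Instr.halt ∧ good c.mem}

end RAMProgram

/-- Words of `c · (⌊log₂ n⌋ + 1)` bits, that is of `O(log n)` bits: the number of words. -/
def wordBound (c n : ℕ) : ℕ := 2 ^ (c * (Nat.log 2 n + 1))

/-! ### Triangle problems -/

open Classical in
/-- The adjacency matrix of a graph on `{0, …, N - 1}`, with zeros outside the range. -/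
noncomputable def adjEntry {N : ℕ} (G : SimpleGraph (Fin N)) (i j : ℕ) : ℕ :=
  if ∃ (hi : i < N) (hj : j < N), G.Adj ⟨i, hi⟩ ⟨j, hj⟩ then 1 else 0

/-- The number of triangles of a graph. -/
noncomputable def triangleCount {N : ℕ} (G : SimpleGraph (Fin N)) : ℕ := (G.cliqueSet 3).ncard

/-- The part of a vertex of a tripartite graph with consecutive parts `A = {0, …, n - 1}`,
`B = {n, …, n + m - 1}` and `C = {n + m, …, n + m + n - 1}`. -/
def tripartPart (n m v : ℕ) : Fin 3 := if v < n then 0 else if v < n + m then 1 else 2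

/-- `G` is tripartite with the parts `A`, `B`, `C` of sizes `n`, `m`, `n`. -/
def IsTripartite (n m : ℕ) (G : SimpleGraph (Fin (n + m + n))) : Prop :=
  ∀ u v, G.Adj u v → tripartPart n m u ≠ tripartPart n m v

open Classical in
/-- The output (memory cell `0`) is `1` if `G` contains a triangle and `0` otherwise. -/
def DetectsTriangle {N : ℕ} (G : SimpleGraph (Fin N)) (mem : ℕ → ℕ) : Prop :=
  mem 0 = if G.CliqueFree 3 then 0 else 1

/-- The output is a fraction `p / q`, with `p` in memory cell `0` and `q` in memory cell `1`, and
lies in `[(1 - ε) t, (1 + ε) t]`. -/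
def IsApproxOutput (ε : ℝ) (t : ℕ) (mem : ℕ → ℕ) : Prop :=
  mem 1 ≠ 0 ∧ (1 - ε) * t ≤ (mem 0 : ℝ) / mem 1 ∧ (mem 0 : ℝ) / mem 1 ≤ (1 + ε) * t

/-- The hardness hypothesis for unbalanced triangle detection, for the exponent `b`: for no `δ > 0`
is there a randomized word-RAM program with words of `O(log n)` bits that decides whether a
tripartite graph with parts of sizes `n`, `n ^ b`, `n` contains a triangle, with probability at
least `2 / 3` and in `O(MM(n, n ^ b, n) ^ (1 - δ))` steps. The program is given `n` and the
size of the middle part, and access to the adjacency matrix. -/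
def UnbalancedTriangleHypothesis (F : Type*) [Field F] (b : ℝ) : Prop :=
  ∀ δ : ℝ, 0 < δ → ¬ ∃ (P : RAMProgram) (c : ℕ) (K : ℝ), ∀ n : ℕ, 1 ≤ n →
    ∀ G : SimpleGraph (Fin (n + powDim n b + n)), IsTripartite n (powDim n b) G →
      ∃ k : ℕ, (k : ℝ) ≤ K * (MM F n 1 b 1) ^ (1 - δ) ∧
        2 / 3 ≤ P.successProb (adjEntry G) (wordBound c n) [n, powDim n b] k (DetectsTriangle G)

/-- The program `P`, with words of `O(log n)` bits, approximates the number of triangles of the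
`n`-vertex graphs that have no triangle or at least `t n` triangles, up to a factor `1 ± ε` and with
probability at least `2 / 3`, and takes at most `T n` steps for that on the graphs with at least
`t n` triangles. The program is given `n` and access to the adjacency matrix. -/
def ApproximatesTriangles (P : RAMProgram) (ε : ℝ) (t T : ℕ → ℝ) : Prop :=
  ∃ c : ℕ, ∀ n : ℕ, 1 ≤ n → ∀ G : SimpleGraph (Fin n),
    (triangleCount G = 0 → ∃ k : ℕ,
      2 / 3 ≤ P.successProb (adjEntry G) (wordBound c n) [n] k
        (IsApproxOutput ε (triangleCount G))) ∧
    (t n ≤ (triangleCount G : ℝ) → ∃ k : ℕ, (k : ℝ) ≤ T n ∧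
      2 / 3 ≤ P.successProb (adjEntry G) (wordBound c n) [n] k
        (IsApproxOutput ε (triangleCount G)))

/-! ### Bounds for the exponent of rectangular matrix multiplication -/

/-! The proof is a gap-creating reduction. Every vertex of a tripartite graph is replaced by
independent copies: each part grows to `L * n` vertices, with `L` a constant depending on `κ`. A
triangle-free graph stays triangle-free. The middle part has only about `n ^ b` vertices, so each of
them gets about `L * n ^ (1 - b)` copies, and a single triangle turns into at least `L * (L * n /
m)` triangles, where `m` is the size of the middle part. For large `L` this exceeds `κ * N ^ (1 -
b)` with `N = 3 * L * n` (`triangleCount_blowUp_of_cliqueFree`, `le_triangleCount_blowUp`,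
`threshold_le`). As `ε < 1`, an approximate count is zero exactly when the true count is, so it
decides triangle detection.

The blow-up is never written down: a query to it is answered by reducing indices modulo `n` or `m`.
The approximation algorithm may run arbitrarily long on triangle-free graphs, so it is stopped by a
clock; a time-out answers "no triangle", which is right because the time bound holds on all blow-ups
that have triangles. The detector therefore succeeds with at least the probability of the original
program, which `RAMProgram.Simulates.succFrom_le` proves by induction on the clock
(`RAMProgram.successProb_le_clocked`).

The clock must be computable on the machine although `ω` is an arbitrary real. A rational exponent
`p / q` strictly between `ω * (1 - δ)` and `ω * (1 - δ')` is used, and `n ^ (p / q)` is replaced by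
a power of two that agrees with it up to constant factors. That such a rational exists, and can be
taken positive, rests on `two_le_omegaExp`. -/

/-- The substitution that sends the entries `(i, j)` and `(j, k)` of the two generic matrices to the
variable of a polynomial ring and all other entries to zero. -/
noncomputable def matMulProbe (F : Type*) [Field F] {p q r : ℕ} (i : Fin p) (j : Fin q) (k : Fin r) :
    MatMulRing F p q r →ₐ[F] Polynomial F :=
  MvPolynomial.aeval (Sum.elim (fun u => if u = (i, j) then Polynomial.X else 0)
    (fun u => if u = (j, k) then Polynomial.X else 0))

theorem matMulProbe_entry (F : Type*) [Field F] {p q r : ℕ} (i : Fin p) (j : Fin q) (k : Fin r)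
    (i' : Fin p) (k' : Fin r) :
    matMulProbe F i j k (matMulEntry F p q r i' k') =
      if i' = i ∧ k' = k then Polynomial.X ^ 2 else 0 := by
  simp only [matMulProbe, matMulEntry, map_sum, map_mul, MvPolynomial.aeval_X, Sum.elim_inl,
    Sum.elim_inr, Prod.mk.injEq]
  rw [Finset.sum_eq_single j]
  · split_ifs <;> simp_all [sq]
  · intro x _ hx; simp [hx]
  · simp

/-- The probe sends the entry to a polynomial of degree two and every free element to one of degree
at most one. The index `j` witnesses that the inner dimension is positive; otherwise the entry would
be the constant zero and free. -/
theorem matMulEntry_notMem_inputs (F : Type*) [Field F] {p q r : ℕ} (j : Fin q) (i : Fin p)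
    (k : Fin r) : matMulEntry F p q r i k ∉ matMulInputs F p q r := by
  intro h
  have key := matMulProbe_entry F i j k i k
  simp only [and_self, if_true] at key
  have hdeg := congrArg Polynomial.natDegree key
  rw [Polynomial.natDegree_X_pow] at hdeg
  rcases h with ⟨v, hv⟩ | ⟨a, ha⟩
  · rw [← hv] at hdeg
    rcases v with v | v <;>
    · simp only [matMulProbe, MvPolynomial.aeval_X, Sum.elim_inl, Sum.elim_inr] at hdeg
      split_ifs at hdeg <;> simp at hdeg
  · rw [← ha] at hdeg
    simp [matMulProbe] at hdeg

theorem matMulEntry_injective (F : Type*) [Field F] {p q r : ℕ} (j : Fin q) :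
    Function.Injective fun u : Fin p × Fin r => matMulEntry F p q r u.1 u.2 := by
  rintro ⟨i, k⟩ ⟨i', k'⟩ h
  have h1 := congrArg (matMulProbe F i j k) h
  simp only [matMulProbe_entry, and_self, if_true] at h1
  split_ifs at h1 with h2
  · exact Prod.ext h2.1.symm h2.2.symm
  · simp at h1

/-- Every program for the matrix product has to compute all the entries of the product. -/
theorem MatMulIn.le_length {F : Type*} [Field F] {p q r L : ℕ} (hq : 0 < q)
    (h : MatMulIn F p q r L) : p * r ≤ L := by
  classical
  obtain ⟨l, -, hl, h⟩ := h
  have hsub : Finset.univ.image (fun u : Fin p × Fin r => matMulEntry F p q r u.1 u.2)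
      ⊆ l.toFinset := by
    intro x hx
    obtain ⟨u, -, rfl⟩ := Finset.mem_image.1 hx
    exact List.mem_toFinset.2
      ((h u.1 u.2).resolve_left (matMulEntry_notMem_inputs F ⟨0, hq⟩ _ _))
  have := Finset.card_le_card hsub
  rw [Finset.card_image_of_injective _ (matMulEntry_injective F ⟨0, hq⟩)] at this
  simp only [Finset.card_univ, Fintype.card_prod, Fintype.card_fin] at this
  exact this.trans ((List.toFinset_card_le l).trans hl)

/-- A program can be extended so that it also computes a given sum of products. -/
theorem StraightLine.exists_sum_mul {R ι : Type*} [CommRing R] {S : Set R} (h0 : (0 : R) ∈ S)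
    (f g : ι → R) (hf : ∀ i, f i ∈ S) (hg : ∀ i, g i ∈ S) (s : Finset ι) {l : List R}
    (hl : StraightLine S l) :
    ∃ l', StraightLine S l' ∧ l ⊆ l' ∧ l'.length ≤ l.length + 2 * s.card ∧
      (∑ i ∈ s, f i * g i ∈ S ∨ ∑ i ∈ s, f i * g i ∈ l') := by
  classical
  induction s using Finset.induction_on with
  | empty => exact ⟨l, hl, fun _ h => h, by simp, by simp [h0]⟩
  | insert a s ha ih =>
    obtain ⟨l', h1, h2, h3, h4⟩ := ih
    refine ⟨(f a * g a + ∑ i ∈ s, f i * g i) :: (f a * g a) :: l', ?_, ?_, ?_, ?_⟩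
    · refine .add _ _ _ (.mul _ _ _ h1 (.inl (hf a)) (.inl (hg a))) (.inr (by simp)) ?_
      exact h4.imp id fun h => List.mem_cons_of_mem _ h
    · exact fun x hx => by simp [h2 hx]
    · rw [Finset.card_insert_of_notMem ha]; simp only [List.length_cons]; omega
    · rw [Finset.sum_insert ha]; simp

/-- The schoolbook algorithm. -/
theorem matMulIn_schoolbook (F : Type*) [Field F] (p q r : ℕ) :
    MatMulIn F p q r (p * r * (2 * q)) := by
  classical
  have key : ∀ s : Finset (Fin p × Fin r), ∃ l : List (MatMulRing F p q r),
      StraightLine (matMulInputs F p q r) l ∧ l.length ≤ s.card * (2 * q) ∧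
      ∀ u ∈ s, matMulEntry F p q r u.1 u.2 ∈ matMulInputs F p q r ∨
        matMulEntry F p q r u.1 u.2 ∈ l := by
    intro s
    induction s using Finset.induction_on with
    | empty => exact ⟨[], .nil, by simp, by simp⟩
    | insert a s ha ih =>
      obtain ⟨l, h1, h2, h3⟩ := ih
      obtain ⟨l', h4, h5, h6, h7⟩ := StraightLine.exists_sum_mul
        (S := matMulInputs F p q r) (.inr ⟨0, by simp⟩)
        (fun j : Fin q => MvPolynomial.X (Sum.inl (a.1, j)))
        (fun j : Fin q => MvPolynomial.X (Sum.inr (j, a.2)))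
        (fun j => .inl ⟨_, rfl⟩) (fun j => .inl ⟨_, rfl⟩) Finset.univ h1
      refine ⟨l', h4, ?_, ?_⟩
      · rw [Finset.card_insert_of_notMem ha, add_mul, one_mul]
        simp only [Finset.card_univ, Fintype.card_fin] at h6
        omega
      · intro u hu
        rcases Finset.mem_insert.1 hu with rfl | hu
        · exact h7
        · exact (h3 u hu).imp id fun h => h5 h
  obtain ⟨l, h1, h2, h3⟩ := key Finset.univ
  refine ⟨l, h1, ?_, fun i k => h3 (i, k) (Finset.mem_univ _)⟩
  simpa using h2

theorem powDim_one (n : ℕ) : powDim n 1 = n := by simp [powDim]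

theorem powDim_pos {n : ℕ} (hn : 1 ≤ n) {b : ℝ} (hb : 0 ≤ b) : 1 ≤ powDim n b :=
  Nat.le_floor (by simpa using Real.one_le_rpow (by exact_mod_cast hn) hb)

theorem powDim_le_self {n : ℕ} (hn : 1 ≤ n) {b : ℝ} (hb : b ≤ 1) : powDim n b ≤ n := by
  have := Nat.floor_le_floor (Real.rpow_le_rpow_of_exponent_le (x := n) (by exact_mod_cast hn) hb)
  simpa [powDim] using this

/-- A product with nonempty inner dimension has `n * n` distinct entries, none of them free, so
fewer than quadratically many operations cannot suffice. The reduction only uses that the exponent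
is positive. -/
theorem two_le_omegaExp (F : Type*) [Field F] {b : ℝ} (hb₀ : 0 ≤ b) (hb₁ : b ≤ 1) :
    2 ≤ omegaExp F 1 b 1 := by
  -- The schoolbook bound (exponent 3, constant 2) shows that the set is nonempty; the infimum of an
  -- empty set of reals would be 0 by default.
  refine le_csInf ⟨3, 2, fun n hn => ⟨_, ?_, matMulIn_schoolbook F _ _ _⟩⟩ ?_
  · rw [powDim_one]
    have h := powDim_le_self hn hb₁
    have : n * n * (2 * powDim n b) ≤ n * n * (2 * n) := by gcongr
    have h2 : ((n * n * (2 * powDim n b) : ℕ) : ℝ) ≤ ((n * n * (2 * n) : ℕ) : ℝ) := by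
      exact_mod_cast this
    refine h2.trans (le_of_eq ?_)
    rw [show (3 : ℝ) = ((3 : ℕ) : ℝ) by norm_num, Real.rpow_natCast]
    push_cast; ring
  · rintro τ ⟨K, hK⟩
    by_contra! hτ
    have htend : Filter.Tendsto (fun n : ℕ => (n : ℝ) ^ (2 - τ)) Filter.atTop Filter.atTop :=
      (tendsto_rpow_atTop (by linarith)).comp tendsto_natCast_atTop_atTop
    obtain ⟨n, hn1, hn2⟩ :=
      ((htend.eventually_gt_atTop K).and (Filter.eventually_ge_atTop 1)).exists
    obtain ⟨L, hL, hmm⟩ := hK n hn2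
    have h := hmm.le_length (powDim_pos hn2 hb₀)
    rw [powDim_one] at h
    have hn0 : (0 : ℝ) < n := by exact_mod_cast hn2
    have h1 : ((n * n : ℕ) : ℝ) ≤ K * (n : ℝ) ^ τ := le_trans (by exact_mod_cast h) hL
    have h2 : ((n * n : ℕ) : ℝ) = (n : ℝ) ^ (2 - τ) * (n : ℝ) ^ τ := by
      rw [← Real.rpow_add hn0, sub_add_cancel, Real.rpow_two]; push_cast; ring
    rw [h2] at h1
    exact absurd (le_of_mul_le_mul_right h1 (Real.rpow_pos_of_pos hn0 _)) (not_le.2 hn1)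

/-! ### Runs of word-RAM programs -/

namespace RAMProgram

variable (P : RAMProgram) (adj : ℕ → ℕ → ℕ) (W : ℕ) (good : (ℕ → ℕ) → Prop)

/-- One step from a possibly failed state. -/
noncomputable def next : Option P.Config → PMF (Option P.Config)
  | none => PMF.pure none
  | some c => P.step adj W c

/-- The distribution of the state `k` steps after the state `s`. -/
noncomputable def runFrom : ℕ → Option P.Config → PMF (Option P.Config)
  | 0, s => PMF.pure s
  | k + 1, s => (P.next adj W s).bind (runFrom k)

/-- `run` appends steps at the end, whereas the simulation argues by the first step of a run;
associativity of `bind` reconciles the two recursions. -/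
theorem runFrom_succ' (k : ℕ) (s : Option P.Config) :
    P.runFrom adj W (k + 1) s = (P.runFrom adj W k s).bind (P.next adj W) := by
  induction k generalizing s with
  | zero =>
    simp only [runFrom, PMF.pure_bind]
    exact PMF.bind_pure _
  | succ k ih =>
    rw [runFrom, runFrom, PMF.bind_bind]
    congr 1
    funext t
    exact ih t

theorem run_eq_runFrom (input : List ℕ) (k : ℕ) :
    P.run adj W input k = P.runFrom adj W k (some (P.init input)) := by
  induction k with
  | zero => rfl
  | succ k ih =>
    rw [runFrom_succ', ← ih, run]
    congr 1

/-- The probability of having halted in a good state `k` steps after the state `s`. -/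
noncomputable def succFrom (k : ℕ) (s : Option P.Config) : ENNReal :=
  (P.runFrom adj W k s).toOuterMeasure
    {s | ∃ c : P.Config, s = some c ∧ P.code c.pc = Instr.halt ∧ good c.mem}

theorem successProb_eq_succFrom (input : List ℕ) (k : ℕ) :
    P.successProb adj W input k good = P.succFrom adj W good k (some (P.init input)) := by
  rw [successProb, run_eq_runFrom, succFrom]

theorem succFrom_succ (k : ℕ) (s : Option P.Config) :
    P.succFrom adj W good (k + 1) s =
      ∑' t, P.next adj W s t * P.succFrom adj W good k t := by
  simp only [succFrom, runFrom, PMF.toOuterMeasure_bind_apply]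

theorem succFrom_none (k : ℕ) : P.succFrom adj W good k none = 0 := by
  induction k with
  | zero => simp [succFrom, runFrom, PMF.toOuterMeasure_pure_apply]
  | succ k ih =>
    rw [succFrom, runFrom, next, PMF.pure_bind]
    exact ih

variable {P adj W good}

theorem succFrom_of_step_eq_pure {c : P.Config} {s : Option P.Config}
    (h : P.step adj W c = PMF.pure s) (k : ℕ) :
    P.succFrom adj W good (k + 1) (some c) = P.succFrom adj W good k s := by
  rw [succFrom, runFrom, next, h, PMF.pure_bind]
  rfl

theorem step_halt {c : P.Config} (h : P.code c.pc = Instr.halt) :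
    P.step adj W c = PMF.pure (some c) := by
  rw [step, h]

open Classical in
theorem succFrom_halt {c : P.Config} (h : P.code c.pc = Instr.halt) (k : ℕ) :
    P.succFrom adj W good k (some c) = if good c.mem then 1 else 0 := by
  induction k with
  | zero =>
    rw [succFrom, runFrom, PMF.toOuterMeasure_pure_apply]
    congr 1
    simp [h]
  | succ k ih => rw [succFrom_of_step_eq_pure (step_halt h), ih]

theorem succFrom_zero_of_not_halt {c : P.Config} (h : P.code c.pc ≠ Instr.halt) :
    P.succFrom adj W good 0 (some c) = 0 := by
  rw [succFrom, runFrom, PMF.toOuterMeasure_pure_apply, if_neg]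
  rintro ⟨c', h1, h2, -⟩
  cases h1
  exact h h2

theorem succFrom_le_one (k : ℕ) (s : Option P.Config) : P.succFrom adj W good k s ≤ 1 := by
  have h := (P.runFrom adj W k s).toOuterMeasure_mono (s := {s | ∃ c : P.Config, s = some c ∧
    P.code c.pc = Instr.halt ∧ good c.mem}) (t := Set.univ) (fun _ _ => Set.mem_univ _)
  refine h.trans (le_of_eq ?_)
  rw [PMF.toOuterMeasure_apply]
  simp [(P.runFrom adj W k s).tsum_coe]

/-- A halted configuration never changes, so success is never lost. This lets simulations with
different step counts be compared after padding. -/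
theorem succFrom_le_succ (k : ℕ) (s : Option P.Config) :
    P.succFrom adj W good k s ≤ P.succFrom adj W good (k + 1) s := by
  classical
  induction k generalizing s with
  | zero =>
    cases s with
    | none => simp [succFrom_none]
    | some c =>
      by_cases h : P.code c.pc = Instr.halt
      · simp [succFrom_halt h]
      · simp [succFrom_zero_of_not_halt h]
  | succ k ih =>
    rw [succFrom_succ, succFrom_succ _ _ _ _ (k + 1)]
    exact ENNReal.tsum_le_tsum fun t => by gcongr; exact ih t

theorem succFrom_mono {k l : ℕ} (h : k ≤ l) (s : Option P.Config) :
    P.succFrom adj W good k s ≤ P.succFrom adj W good l s :=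
  monotone_nat_of_le_succ (f := fun k => P.succFrom adj W good k s)
    (fun k => succFrom_le_succ k s) h

/-- The uniform distribution on `{0, …, x}`. -/
noncomputable def uniformUpTo (x : ℕ) : PMF ℕ :=
  (PMF.uniformOfFintype (Fin (x + 1))).bind fun v => PMF.pure (v : ℕ)

/-- The weights depend only on the content of the register, so the sums for two programs can be
compared term by term. -/
theorem succFrom_rand {c : P.Config} {r x : P.Reg} {next : P.Label}
    (h : P.code c.pc = Instr.rand r x next) (k : ℕ) :
    P.succFrom adj W good (k + 1) (some c) =
      ∑' v, uniformUpTo (c.reg x) v * P.succFrom adj W good k (P.put W c r v next) := by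
  rw [succFrom, runFrom, RAMProgram.next, step, h]
  simp only [PMF.bind_map, PMF.toOuterMeasure_bind_apply]
  rfl

/-- From `c` the program gets to `c'` in `j` steps, all of them deterministic and without
overflow. -/
inductive Reaches (P : RAMProgram) (adj : ℕ → ℕ → ℕ) (W : ℕ) :
    ℕ → P.Config → P.Config → Prop
  | refl (c : P.Config) : Reaches P adj W 0 c c
  | head {j : ℕ} {c c' c'' : P.Config} : P.step adj W c = PMF.pure (some c') →
      Reaches P adj W j c' c'' → Reaches P adj W (j + 1) c c''

theorem Reaches.trans {i j : ℕ} {c c' c'' : P.Config} (h : Reaches P adj W i c c')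
    (h' : Reaches P adj W j c' c'') : Reaches P adj W (i + j) c c'' := by
  induction h with
  | refl => simpa using h'
  | head h1 _ ih => rw [Nat.add_right_comm]; exact .head h1 (ih h')

theorem Reaches.succFrom_eq {j : ℕ} {c c' : P.Config} (h : Reaches P adj W j c c') (k : ℕ) :
    P.succFrom adj W good (k + j) (some c) = P.succFrom adj W good k (some c') := by
  induction h with
  | refl => rfl
  | head h1 _ ih => rw [← add_assoc, succFrom_of_step_eq_pure h1, ih]

theorem Reaches.succFrom_le {j k l : ℕ} {c c' : P.Config} (h : Reaches P adj W j c c')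
    (hl : k + j ≤ l) :
    P.succFrom adj W good k (some c') ≤ P.succFrom adj W good l (some c) :=
  (h.succFrom_eq k).symm.le.trans (succFrom_mono hl _)

theorem put_of_lt {c : P.Config} {r : P.Reg} {v : ℕ} {next : P.Label} (h : v < W) :
    P.put W c r v next = some ⟨next, open Classical in Function.update c.reg r v, c.mem⟩ :=
  if_pos h

theorem put_of_not_lt {c : P.Config} {r : P.Reg} {v : ℕ} {next : P.Label} (h : ¬ v < W) :
    P.put W c r v next = none :=
  if_neg h

open Classical in
theorem Reaches.lit {j : ℕ} {c c' : P.Config} {r : P.Reg} {v : ℕ} {next : P.Label}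
    (h : P.code c.pc = .lit r v next) (hv : v < W)
    (h' : Reaches P adj W j ⟨next, Function.update c.reg r v, c.mem⟩ c') :
    Reaches P adj W (j + 1) c c' :=
  .head (by rw [step, h]; simp only [put_of_lt hv]) h'

open Classical in
theorem Reaches.op {j : ℕ} {c c' : P.Config} {o : WordOp} {r x y : P.Reg} {next : P.Label}
    (h : P.code c.pc = .op o r x y next) (hv : o.eval (c.reg x) (c.reg y) < W)
    (h' : Reaches P adj W j
      ⟨next, Function.update c.reg r (o.eval (c.reg x) (c.reg y)), c.mem⟩ c') :
    Reaches P adj W (j + 1) c c' :=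
  .head (by rw [step, h]; simp only [put_of_lt hv]) h'

open Classical in
theorem Reaches.load {j : ℕ} {c c' : P.Config} {r x : P.Reg} {next : P.Label}
    (h : P.code c.pc = .load r x next) (hv : c.mem (c.reg x) < W)
    (h' : Reaches P adj W j ⟨next, Function.update c.reg r (c.mem (c.reg x)), c.mem⟩ c') :
    Reaches P adj W (j + 1) c c' :=
  .head (by rw [step, h]; simp only [put_of_lt hv]) h'

theorem Reaches.store {j : ℕ} {c c' : P.Config} {x y : P.Reg} {next : P.Label}
    (h : P.code c.pc = .store x y next)
    (h' : Reaches P adj W j ⟨next, c.reg, Function.update c.mem (c.reg x) (c.reg y)⟩ c') :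
    Reaches P adj W (j + 1) c c' :=
  .head (by rw [step, h]) h'

theorem Reaches.branch_yes {j : ℕ} {c c' : P.Config} {x y : P.Reg} {yes no : P.Label}
    (h : P.code c.pc = .branch x y yes no) (hv : c.reg x < c.reg y)
    (h' : Reaches P adj W j ⟨yes, c.reg, c.mem⟩ c') :
    Reaches P adj W (j + 1) c c' :=
  .head (by rw [step, h]; simp only [if_pos hv]) h'

theorem Reaches.branch_no {j : ℕ} {c c' : P.Config} {x y : P.Reg} {yes no : P.Label}
    (h : P.code c.pc = .branch x y yes no) (hv : ¬ c.reg x < c.reg y)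
    (h' : Reaches P adj W j ⟨no, c.reg, c.mem⟩ c') :
    Reaches P adj W (j + 1) c c' :=
  .head (by rw [step, h]; simp only [if_neg hv]) h'

end RAMProgram

/-! ### Simulating a program on a blown-up graph, with a clock -/

/-- The vertex of a tripartite graph with parts of sizes `n`, `m`, `n` that the vertex `v` of its
blow-up is a copy of: the first `L * n` vertices of the blow-up are copies of vertices in the middle
part, the next `L * n` of vertices in the first part, and the others of vertices in the last part. -/
def blowUpVertex (L n m v : ℕ) : ℕ :=
  if v < L * n then v % m + n else if v < L * n + L * n then v % n else v % n + (n + m)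

/-- The adjacency matrix of the blow-up. -/
def blowUpEntry (L n m : ℕ) (adj : ℕ → ℕ → ℕ) (x y : ℕ) : ℕ :=
  if x < L * n + L * n + L * n ∧ y < L * n + L * n + L * n then
    adj (blowUpVertex L n m x) (blowUpVertex L n m y) else 0

/-- The additional registers of the simulating program. -/
inductive ClockReg
  | zero | one | n | m | nm | ln | lln | size | clock | aux | tmp (second : Bool)
  deriving Fintype

namespace RAMProgram

/-- The part of the simulating program that prepares the input and the clock. -/
def setupCode (P : RAMProgram) (L p q C : ℕ) :
    Fin 20 → Instr (P.Reg ⊕ ClockReg) (Fin 20 ⊕ Fin 5 ⊕ P.Label × (Fin 6 ⊕ Bool × Fin 7))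
  | 0 => .lit (.inr .one) 1 (.inl 1)
  | 1 => .load (.inr .n) (.inr .zero) (.inl 2)
  | 2 => .load (.inr .m) (.inr .one) (.inl 3)
  -- The simulated program expects a single input number, so cell 1 is cleared once `m` has been
  -- read; cell 0 later receives the size of the blow-up.
  | 3 => .store (.inr .one) (.inr .zero) (.inl 4)
  | 4 => .op .add (.inr .nm) (.inr .n) (.inr .m) (.inl 5)
  | 5 => .lit (.inr .aux) L (.inl 6)
  | 6 => .op .mul (.inr .ln) (.inr .aux) (.inr .n) (.inl 7)
  | 7 => .op .add (.inr .lln) (.inr .ln) (.inr .ln) (.inl 8)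
  | 8 => .op .add (.inr .size) (.inr .lln) (.inr .ln) (.inl 9)
  | 9 => .store (.inr .zero) (.inr .size) (.inl 10)
  | 10 => .op .add (.inr (.tmp false)) (.inr .n) (.inr .zero) (.inl 11)
  | 11 => .lit (.inr (.tmp true)) 2 (.inl 12)
  | 12 => .lit (.inr .aux) p (.inl 13)
  -- The loop halves a copy of `n` until it is zero and adds `p` to the clock each time.
  | 13 => .branch (.inr .zero) (.inr (.tmp false)) (.inl 14) (.inl 16)
  | 14 => .op .div (.inr (.tmp false)) (.inr (.tmp false)) (.inr (.tmp true)) (.inl 15)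
  | 15 => .op .add (.inr .clock) (.inr .clock) (.inr .aux) (.inl 13)
  | 16 => .lit (.inr .aux) q (.inl 17)
  | 17 => .op .div (.inr .clock) (.inr .clock) (.inr .aux) (.inl 18)
  | 18 => .lit (.inr .aux) C (.inl 19)
  | _ => .op .shl (.inr .clock) (.inr .aux) (.inr .clock) (.inr (.inr (P.start, .inl 0)))

/-- The part of the simulating program that writes the output. -/
def finishCode (P : RAMProgram) :
    Fin 5 → Instr (P.Reg ⊕ ClockReg) (Fin 20 ⊕ Fin 5 ⊕ P.Label × (Fin 6 ⊕ Bool × Fin 7))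
  | 0 => .load (.inr .aux) (.inr .zero) (.inr (.inl 1))
  | 1 => .branch (.inr .zero) (.inr .aux) (.inr (.inl 2)) (.inr (.inl 3))
  | 2 => .store (.inr .zero) (.inr .one) (.inr (.inl 4))
  | 3 => .store (.inr .zero) (.inr .zero) (.inr (.inl 4))
  | 4 => .halt

/-- The part of the simulating program that replaces the instruction with the label `l`. -/
def bodyCode (P : RAMProgram) (l : P.Label) : Instr P.Reg P.Label → Fin 6 ⊕ Bool × Fin 7 →
    Instr (P.Reg ⊕ ClockReg) (Fin 20 ⊕ Fin 5 ⊕ P.Label × (Fin 6 ⊕ Bool × Fin 7))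
  -- Halting is recognised before the clock is checked, so a run that uses up the clock exactly is
  -- still read out.
  | .halt, .inl 0 => .lit (.inr .aux) 0 (.inr (.inl 0))
  | _, .inl 0 => .branch (.inr .zero) (.inr .clock) (.inr (.inr (l, .inl 1))) (.inr (.inl 3))
  | _, .inl 1 => .op .sub (.inr .clock) (.inr .clock) (.inr .one) (.inr (.inr (l, .inl 2)))
  | .lit r v next, .inl 2 => .lit (.inl r) v (.inr (.inr (next, .inl 0)))
  | .op o r x y next, .inl 2 => .op o (.inl r) (.inl x) (.inl y) (.inr (.inr (next, .inl 0)))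
  | .load r x next, .inl 2 => .load (.inl r) (.inl x) (.inr (.inr (next, .inl 0)))
  | .store x y next, .inl 2 => .store (.inl x) (.inl y) (.inr (.inr (next, .inl 0)))
  | .rand r x next, .inl 2 => .rand (.inl r) (.inl x) (.inr (.inr (next, .inl 0)))
  | .branch x y yes no, .inl 2 =>
      .branch (.inl x) (.inl y) (.inr (.inr (yes, .inl 0))) (.inr (.inr (no, .inl 0)))
  | .query _ x _ _, .inl 2 =>
      .branch (.inl x) (.inr .size) (.inr (.inr (l, .inl 3))) (.inr (.inr (l, .inl 4)))
  | .query _ _ y _, .inl 3 =>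
      .branch (.inl y) (.inr .size) (.inr (.inr (l, .inr (false, 0)))) (.inr (.inr (l, .inl 4)))
  | .query r _ _ next, .inl 4 => .lit (.inl r) 0 (.inr (.inr (next, .inl 0)))
  | .query r _ _ next, .inl 5 =>
      .query (.inl r) (.inr (.tmp false)) (.inr (.tmp true)) (.inr (.inr (next, .inl 0)))
  | .query _ x y _, .inr (s, i) =>
      let w : P.Reg ⊕ ClockReg := .inl (if s then y else x)
      let t : P.Reg ⊕ ClockReg := .inr (.tmp s)
      let done : Fin 20 ⊕ Fin 5 ⊕ P.Label × (Fin 6 ⊕ Bool × Fin 7) :=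
        .inr (.inr (l, if s then .inl 5 else .inr (true, 0)))
      match i with
      | 0 => .branch w (.inr .ln) (.inr (.inr (l, .inr (s, 1)))) (.inr (.inr (l, .inr (s, 3))))
      | 1 => .op .mod t w (.inr .m) (.inr (.inr (l, .inr (s, 2))))
      | 2 => .op .add t t (.inr .n) done
      | 3 => .branch w (.inr .lln) (.inr (.inr (l, .inr (s, 4)))) (.inr (.inr (l, .inr (s, 5))))
      | 4 => .op .mod t w (.inr .n) done
      | 5 => .op .mod t w (.inr .n) (.inr (.inr (l, .inr (s, 6))))
      | 6 => .op .add t t (.inr .nm) done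
  | _, _ => .halt

/-- The program that is given the sizes `n` and `m` and a tripartite graph, runs `P` on the blow-up
of the graph for at most `C * 2 ^ (p * (⌊log₂ n⌋ + 1) / q)` steps, and then outputs `1` if `P` has
halted with a positive output and `0` otherwise. -/
def clocked (P : RAMProgram) (L p q C : ℕ) : RAMProgram where
  Reg := P.Reg ⊕ ClockReg
  Label := Fin 20 ⊕ Fin 5 ⊕ P.Label × (Fin 6 ⊕ Bool × Fin 7)
  finite_reg := have := P.finite_reg; inferInstance
  finite_label := have := P.finite_label; inferInstance
  start := .inl 0
  code
    | .inl i => P.setupCode L p q C i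
    | .inr (.inl i) => P.finishCode i
    | .inr (.inr (l, i)) => P.bodyCode l (P.code l) i

/-! ### The simulation invariant and the translation of queries. -/

variable {P : RAMProgram} {L p q C : ℕ}

/-- A register of `P` as a register of the simulating program. -/
def simReg (r : P.Reg) : (P.clocked L p q C).Reg := .inl r

/-- An additional register as a register of the simulating program. -/
def ctlReg (r : ClockReg) : (P.clocked L p q C).Reg := .inr r

@[simp] theorem simReg_inj {r r' : P.Reg} :
    (simReg r : (P.clocked L p q C).Reg) = simReg r' ↔ r = r' := Sum.inl_injective.eq_iff

@[simp] theorem ctlReg_inj {r r' : ClockReg} :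
    (ctlReg r : (P.clocked L p q C).Reg) = ctlReg r' ↔ r = r' := Sum.inr_injective.eq_iff

@[simp] theorem simReg_ne_ctlReg {r : P.Reg} {r' : ClockReg} :
    ((simReg r : (P.clocked L p q C).Reg) = ctlReg r') ↔ False := ⟨Sum.inl_ne_inr, False.elim⟩

@[simp] theorem ctlReg_ne_simReg {r : P.Reg} {r' : ClockReg} :
    ((ctlReg r' : (P.clocked L p q C).Reg) = simReg r) ↔ False := ⟨Sum.inr_ne_inl, False.elim⟩

/-- The labels of the simulating program. -/
def setupLabel (i : Fin 20) : (P.clocked L p q C).Label := .inl i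

def finishLabel (i : Fin 5) : (P.clocked L p q C).Label := .inr (.inl i)

def bodyLabel (l : P.Label) (i : Fin 6 ⊕ Bool × Fin 7) : (P.clocked L p q C).Label :=
  .inr (.inr (l, i))

theorem code_bodyLabel (l : P.Label) (i : Fin 6 ⊕ Bool × Fin 7) :
    (P.clocked L p q C).code (bodyLabel l i) = P.bodyCode l (P.code l) i := rfl

/-- The configuration `c` of the simulating program represents the configuration `d` of `P`, with
`z` steps left on the clock. -/
structure Simulates (W n m z : ℕ) (c : (P.clocked L p q C).Config) (d : P.Config) : Prop where
  reg : ∀ r, c.reg (simReg r) = d.reg r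
  mem : c.mem = d.mem
  -- Reading the output at the end must not overflow, hence the bound on the memory; the bound on
  -- the registers preserves it under `store`.
  reg_lt : ∀ r, d.reg r < W
  mem_lt : ∀ a, d.mem a < W
  zero : c.reg (ctlReg .zero) = 0
  one : c.reg (ctlReg .one) = 1
  reg_n : c.reg (ctlReg .n) = n
  reg_m : c.reg (ctlReg .m) = m
  reg_nm : c.reg (ctlReg .nm) = n + m
  reg_ln : c.reg (ctlReg .ln) = L * n
  reg_lln : c.reg (ctlReg .lln) = L * n + L * n
  size : c.reg (ctlReg .size) = L * n + L * n + L * n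
  clock : c.reg (ctlReg .clock) = z

section
variable {W W' n m z : ℕ} {adj : ℕ → ℕ → ℕ} {c : (P.clocked L p q C).Config} {d : P.Config}

open Classical in
theorem Simulates.update (h : Simulates W n m z c d) (r : P.Reg) {v : ℕ} (hv : v < W)
    (pc : (P.clocked L p q C).Label) (pc' : P.Label) :
    Simulates W n m z ⟨pc, Function.update c.reg (simReg r) v, c.mem⟩
      ⟨pc', Function.update d.reg r v, d.mem⟩ := by
  obtain ⟨h1, h2, h3, h4, h5, h6, h7, h8, h9, h10, h11, h12, h13⟩ := h
  constructor <;> simp [Function.update_apply, *]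
  intro r'
  split_ifs <;> simp [*]

open Classical in
theorem Simulates.update_tmp (h : Simulates W n m z c d) (s : Bool) (v : ℕ)
    (pc : (P.clocked L p q C).Label) :
    Simulates W n m z ⟨pc, Function.update c.reg (ctlReg (.tmp s)) v, c.mem⟩ d := by
  obtain ⟨h1, h2, h3, h4, h5, h6, h7, h8, h9, h10, h11, h12, h13⟩ := h
  constructor <;> simp [*]

theorem Simulates.jump (h : Simulates W n m z c d) (pc : (P.clocked L p q C).Label)
    (pc' : P.Label) : Simulates W n m z ⟨pc, c.reg, c.mem⟩ ⟨pc', d.reg, d.mem⟩ := by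
  obtain ⟨h1, h2, h3, h4, h5, h6, h7, h8, h9, h10, h11, h12, h13⟩ := h
  constructor <;> simp [*]

theorem Simulates.store (h : Simulates W n m z c d) (x y : P.Reg)
    (pc : (P.clocked L p q C).Label) (pc' : P.Label) :
    Simulates W n m z
      ⟨pc, c.reg, Function.update c.mem (c.reg (simReg x)) (c.reg (simReg y))⟩
      ⟨pc', d.reg, Function.update d.mem (d.reg x) (d.reg y)⟩ := by
  obtain ⟨h1, h2, h3, h4, h5, h6, h7, h8, h9, h10, h11, h12, h13⟩ := h
  constructor <;> simp [Function.update_apply, *]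
  intro a
  split_ifs <;> simp [*]

/-- The subroutine that computes of which vertex a vertex of the blow-up is a copy. -/
theorem Simulates.reaches_blowUpVertex (h : Simulates W n m z c d) (hW : n + m + n < W)
    (hn : 0 < n) (hm : 0 < m) {l : P.Label} {r x y : P.Reg} {next : P.Label}
    (hl : P.code l = .query r x y next) (s : Bool) (hpc : c.pc = bodyLabel l (.inr (s, 0))) :
    ∃ j ≤ 4, Reaches (P.clocked L p q C) adj W j c
      ⟨bodyLabel l (if s then .inl 5 else .inr (true, 0)), open Classical in
        Function.update c.reg (ctlReg (.tmp s)) (blowUpVertex L n m (d.reg (if s then y else x))),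
        c.mem⟩ := by
  classical
  have hcode : ∀ i, (P.clocked L p q C).code (bodyLabel l (.inr (s, i))) =
      P.bodyCode l (.query r x y next) (.inr (s, i)) := fun i => by rw [code_bodyLabel, hl]
  set v : P.Reg := if s then y else x with hv
  set done : (P.clocked L p q C).Label := bodyLabel l (if s then .inl 5 else .inr (true, 0))
  have h0 : (P.clocked L p q C).code (bodyLabel l (.inr (s, 0))) = .branch (simReg v)
    (ctlReg .ln) (bodyLabel l (.inr (s, 1))) (bodyLabel l (.inr (s, 3))) := hcode 0
  have h1 : (P.clocked L p q C).code (bodyLabel l (.inr (s, 1))) = .op .mod (ctlReg (.tmp s))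
    (simReg v) (ctlReg .m) (bodyLabel l (.inr (s, 2))) := hcode 1
  have h2 : (P.clocked L p q C).code (bodyLabel l (.inr (s, 2))) = .op .add (ctlReg (.tmp s))
    (ctlReg (.tmp s)) (ctlReg .n) done := hcode 2
  have h3 : (P.clocked L p q C).code (bodyLabel l (.inr (s, 3))) = .branch (simReg v)
    (ctlReg .lln) (bodyLabel l (.inr (s, 4))) (bodyLabel l (.inr (s, 5))) := hcode 3
  have h4 : (P.clocked L p q C).code (bodyLabel l (.inr (s, 4))) = .op .mod (ctlReg (.tmp s))
    (simReg v) (ctlReg .n) done := hcode 4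
  have h5 : (P.clocked L p q C).code (bodyLabel l (.inr (s, 5))) = .op .mod (ctlReg (.tmp s))
    (simReg v) (ctlReg .n) (bodyLabel l (.inr (s, 6))) := hcode 5
  have h6 : (P.clocked L p q C).code (bodyLabel l (.inr (s, 6))) = .op .add (ctlReg (.tmp s))
    (ctlReg (.tmp s)) (ctlReg .nm) done := hcode 6
  rw [← hpc] at h0
  have hmodm := Nat.mod_lt (d.reg v) hm
  have hmodn := Nat.mod_lt (d.reg v) hn
  unfold blowUpVertex
  by_cases c1 : d.reg v < L * n
  · refine ⟨3, by omega, .branch_yes h0 (by rwa [h.reg, h.reg_ln]) (.op h1 ?_ (.op h2 ?_ ?_))⟩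
    · simp only [WordOp.eval, h.reg, h.reg_m]; omega
    · simp [WordOp.eval, h.reg, h.reg_m, h.reg_n]; omega
    · simp [WordOp.eval, h.reg, h.reg_m, h.reg_n, c1]
      exact .refl _
  by_cases c2 : d.reg v < L * n + L * n
  · refine ⟨3, by omega, .branch_no h0 (by rwa [h.reg, h.reg_ln])
      (.branch_yes h3 (by simpa [h.reg, h.reg_lln]) (.op h4 ?_ ?_))⟩
    · simp only [WordOp.eval, h.reg, h.reg_n]; omega
    · simp [WordOp.eval, h.reg, h.reg_n, c1, c2]
      exact .refl _
  · refine ⟨4, by omega, .branch_no h0 (by rwa [h.reg, h.reg_ln])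
      (.branch_no h3 (by simpa [h.reg, h.reg_lln] using c2) (.op h5 ?_ (.op h6 ?_ ?_)))⟩
    · simp only [WordOp.eval, h.reg, h.reg_n]; omega
    · simp [WordOp.eval, h.reg, h.reg_nm, h.reg_n]; omega
    · simp [WordOp.eval, h.reg, h.reg_nm, h.reg_n, c1, c2]
      exact .refl _

/-- The simulation of a query. -/
theorem Simulates.reaches_query (h : Simulates W n m z c d) (hW : n + m + n < W)
    (hn : 0 < n) (hm : 0 < m) {l : P.Label} {r x y : P.Reg} {next : P.Label}
    (hl : P.code l = .query r x y next) (hpc : c.pc = bodyLabel l (.inl 2)) :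
    ∃ j ≤ 10, ∃ c', Simulates W n m z c' d ∧ Reaches (P.clocked L p q C) adj W j c c' ∧
      (P.clocked L p q C).step adj W c' = PMF.pure ((P.clocked L p q C).put W c' (simReg r)
        (blowUpEntry L n m adj (d.reg x) (d.reg y)) (bodyLabel next (.inl 0))) := by
  classical
  have hcode : ∀ i, (P.clocked L p q C).code (bodyLabel l i) =
      P.bodyCode l (.query r x y next) i := fun i => by rw [code_bodyLabel, hl]
  have h2 : (P.clocked L p q C).code (bodyLabel l (.inl 2)) = .branch (simReg x)
    (ctlReg .size) (bodyLabel l (.inl 3)) (bodyLabel l (.inl 4)) := hcode (.inl 2)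
  have h3 : (P.clocked L p q C).code (bodyLabel l (.inl 3)) = .branch (simReg y)
    (ctlReg .size) (bodyLabel l (.inr (false, 0))) (bodyLabel l (.inl 4)) := hcode (.inl 3)
  have h4 : (P.clocked L p q C).code (bodyLabel l (.inl 4)) = .lit (simReg r) 0
    (bodyLabel next (.inl 0)) := hcode (.inl 4)
  have h5 : (P.clocked L p q C).code (bodyLabel l (.inl 5)) = .query (simReg r)
    (ctlReg (.tmp false)) (ctlReg (.tmp true)) (bodyLabel next (.inl 0)) := hcode (.inl 5)
  rw [← hpc] at h2
  -- Indices outside the blow-up need their own test, since reducing them modulo `n` would give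
  -- genuine vertices instead of the entry zero.
  by_cases cx : d.reg x < L * n + L * n + L * n
  swap
  · refine ⟨1, by omega, _, h.jump (bodyLabel l (.inl 4)) d.pc,
      .branch_no h2 (by rwa [h.reg, h.size]) (.refl _), ?_⟩
    rw [step, h4, blowUpEntry, if_neg (fun h => cx h.1)]
  by_cases cy : d.reg y < L * n + L * n + L * n
  swap
  · refine ⟨2, by omega, _, h.jump (bodyLabel l (.inl 4)) d.pc,
      .branch_yes h2 (by rwa [h.reg, h.size]) (.branch_no h3 (by simpa [h.reg, h.size] using cy)
        (.refl _)), ?_⟩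
    rw [step, h4, blowUpEntry, if_neg (fun h => cy h.2)]
  have s1 := h.jump (bodyLabel l (.inr (false, 0))) d.pc
  obtain ⟨j1, hj1, r1⟩ := s1.reaches_blowUpVertex (adj := adj) hW hn hm hl false rfl
  simp only [Bool.false_eq_true, if_false] at r1
  have s2 := s1.update_tmp false (blowUpVertex L n m (d.reg x)) (bodyLabel l (.inr (true, 0)))
  obtain ⟨j2, hj2, r2⟩ := s2.reaches_blowUpVertex (adj := adj) hW hn hm hl true rfl
  simp only [if_true] at r2
  have s3 := s2.update_tmp true (blowUpVertex L n m (d.reg y)) (bodyLabel l (.inl 5))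
  refine ⟨j1 + j2 + 1 + 1, by omega, _, s3, .branch_yes h2 (by rwa [h.reg, h.size])
    (.branch_yes h3 (by simpa [h.reg, h.size] using cy) (r1.trans r2)), ?_⟩
  rw [step, h5]
  simp [blowUpEntry, cx, cy]

end

end RAMProgram

/-! ### Comparison of success probabilities: output, time-out and single instructions. -/

namespace RAMProgram

variable {P : RAMProgram} {L p q C : ℕ}

section
variable {W W' n m z : ℕ} {adj : ℕ → ℕ → ℕ} {c : (P.clocked L p q C).Config} {d : P.Config}

theorem one_le_succFrom_of_reaches {Q : RAMProgram} {good : (ℕ → ℕ) → Prop} {j k : ℕ}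
    {c c' : Q.Config} (h : Reaches Q adj W j c c') (hc' : Q.code c'.pc = .halt)
    (hg : good c'.mem) (hk : j ≤ k) : 1 ≤ Q.succFrom adj W good k (some c) := by
  refine le_trans ?_ (h.succFrom_le (k := 0) (by omega))
  rw [succFrom_halt hc', if_pos hg]

theorem Simulates.one_le_succFrom_giveUp (h : Simulates W n m z c d)
    (hpc : c.pc = finishLabel 3) {k : ℕ} (hk : 1 ≤ k) :
    1 ≤ (P.clocked L p q C).succFrom adj W (fun mem => mem 0 = 0) k (some c) := by
  have h3 : (P.clocked L p q C).code (finishLabel 3) = .store (ctlReg .zero) (ctlReg .zero)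
    (finishLabel 4) := rfl
  rw [← hpc] at h3
  refine one_le_succFrom_of_reaches (.store h3 (.refl _)) rfl ?_ hk
  simp [h.zero]

theorem Simulates.one_le_succFrom_finish (h : Simulates W n m z c d)
    (hpc : c.pc = finishLabel 0) {k : ℕ} (hk : 3 ≤ k) :
    1 ≤ (P.clocked L p q C).succFrom adj W
      (fun mem => mem 0 = if d.mem 0 = 0 then 0 else 1) k (some c) := by
  have h0 : (P.clocked L p q C).code (finishLabel 0) = .load (ctlReg .aux) (ctlReg .zero)
    (finishLabel 1) := rfl
  have h1 : (P.clocked L p q C).code (finishLabel 1) = .branch (ctlReg .zero) (ctlReg .aux)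
    (finishLabel 2) (finishLabel 3) := rfl
  have h2 : (P.clocked L p q C).code (finishLabel 2) = .store (ctlReg .zero) (ctlReg .one)
    (finishLabel 4) := rfl
  have h3 : (P.clocked L p q C).code (finishLabel 3) = .store (ctlReg .zero) (ctlReg .zero)
    (finishLabel 4) := rfl
  rw [← hpc] at h0
  by_cases hd : d.mem 0 = 0
  · refine one_le_succFrom_of_reaches (.load h0 ?_ (.branch_no h1 ?_ (.store h3 (.refl _)))) rfl
      ?_ hk
    · rw [h.mem]; exact h.mem_lt _
    · simp [h.zero, h.mem, hd]
    · simp [h.zero, hd]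
  · refine one_le_succFrom_of_reaches (.load h0 ?_ (.branch_yes h1 ?_ (.store h2 (.refl _)))) rfl
      ?_ hk
    · rw [h.mem]; exact h.mem_lt _
    · simp [h.zero, h.mem]; omega
    · simp [h.zero, h.one, hd]

open Classical in
theorem Simulates.tick (h : Simulates W n m (z + 1) c d) (hW : z < W)
    (hpc : c.pc = bodyLabel d.pc (.inl 0)) (hd : P.code d.pc ≠ .halt) :
    ∃ c', Simulates W n m z c' d ∧ c'.pc = bodyLabel d.pc (.inl 2) ∧
      Reaches (P.clocked L p q C) adj W 2 c c' := by
  have h0 : (P.clocked L p q C).code (bodyLabel d.pc (.inl 0)) = .branch (ctlReg .zero)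
      (ctlReg .clock) (bodyLabel d.pc (.inl 1)) (finishLabel 3) := by
    rw [code_bodyLabel]
    cases hcode : P.code d.pc <;> first | exact absurd hcode hd | rfl
  have h1 : (P.clocked L p q C).code (bodyLabel d.pc (.inl 1)) = .op .sub (ctlReg .clock)
      (ctlReg .clock) (ctlReg .one) (bodyLabel d.pc (.inl 2)) := by
    rw [code_bodyLabel]
    cases P.code d.pc <;> rfl
  rw [← hpc] at h0
  refine ⟨_, ?_, rfl, .branch_yes h0 (by rw [h.zero, h.clock]; omega) (.op h1 ?_ (.refl _))⟩
  · obtain ⟨h1, h2, h3, h4, h5, h6, h7, h8, h9, h10, h11, h12, h13⟩ := h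
    constructor <;> simp [WordOp.eval, *]
  · simpa [WordOp.eval, h.clock, h.one] using hW

/-- An overflow leaves the simulated program no chance of success, so nothing is to be shown; any
other value also fits into the larger words of the simulator. -/
theorem Simulates.succFrom_put_le {good good' : (ℕ → ℕ) → Prop} {k k' : ℕ} (hW' : W' ≤ W)
    (ih : ∀ (c : (P.clocked L p q C).Config) (d : P.Config), Simulates W n m z c d →
      c.pc = bodyLabel d.pc (.inl 0) →
      P.succFrom (blowUpEntry L n m adj) W' good k (some d) ≤
        (P.clocked L p q C).succFrom adj W good' k' (some c))
    (h : Simulates W n m z c d) (r : P.Reg) (v : ℕ) (next : P.Label) :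
    P.succFrom (blowUpEntry L n m adj) W' good k (P.put W' d r v next) ≤
      (P.clocked L p q C).succFrom adj W good' k'
        ((P.clocked L p q C).put W c (simReg r) v (bodyLabel next (.inl 0))) := by
  by_cases hv : v < W'
  · rw [put_of_lt hv, put_of_lt (hv.trans_le hW')]
    exact ih _ _ (h.update r (hv.trans_le hW') _ _) rfl
  · rw [put_of_not_lt hv, succFrom_none]
    exact zero_le

/-- The simulation of one instruction, once the clock has been checked. -/
theorem Simulates.succFrom_exec_le {good good' : (ℕ → ℕ) → Prop} {k k' : ℕ} (hW' : W' ≤ W)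
    (hW : n + m + n < W) (hn : 0 < n) (hm : 0 < m)
    (ih : ∀ (c : (P.clocked L p q C).Config) (d : P.Config), Simulates W n m z c d →
      c.pc = bodyLabel d.pc (.inl 0) →
      P.succFrom (blowUpEntry L n m adj) W' good k (some d) ≤
        (P.clocked L p q C).succFrom adj W good' k' (some c))
    (h : Simulates W n m z c d) (hpc : c.pc = bodyLabel d.pc (.inl 2))
    (hd : P.code d.pc ≠ .halt) :
    P.succFrom (blowUpEntry L n m adj) W' good (k + 1) (some d) ≤
      (P.clocked L p q C).succFrom adj W good' (k' + 11) (some c) := by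
  classical
  have hcode : (P.clocked L p q C).code c.pc = P.bodyCode d.pc (P.code d.pc) (.inl 2) := by
    rw [hpc, code_bodyLabel]
  -- Only a query needs the full allowance, up to ten steps of index translation and one for the
  -- result; every other instruction takes one step.
  have hmono : (P.clocked L p q C).succFrom adj W good' (k' + 1) (some c) ≤
      (P.clocked L p q C).succFrom adj W good' (k' + 11) (some c) := succFrom_mono (by omega) _
  cases hi : P.code d.pc with
  | lit r v next =>
    refine le_trans ?_ hmono
    have hQ : (P.clocked L p q C).code c.pc = .lit (simReg r) v (bodyLabel next (.inl 0)) := by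
      rw [hcode, hi]; rfl
    rw [succFrom_of_step_eq_pure (by rw [step, hi]), succFrom_of_step_eq_pure (by rw [step, hQ])]
    exact h.succFrom_put_le hW' ih _ _ _
  | op o r x y next =>
    refine le_trans ?_ hmono
    have hQ : (P.clocked L p q C).code c.pc =
        .op o (simReg r) (simReg x) (simReg y) (bodyLabel next (.inl 0)) := by rw [hcode, hi]; rfl
    rw [succFrom_of_step_eq_pure (by rw [step, hi]), succFrom_of_step_eq_pure (by rw [step, hQ]),
      h.reg, h.reg]
    exact h.succFrom_put_le hW' ih _ _ _
  | load r x next =>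
    refine le_trans ?_ hmono
    have hQ : (P.clocked L p q C).code c.pc =
        .load (simReg r) (simReg x) (bodyLabel next (.inl 0)) := by rw [hcode, hi]; rfl
    rw [succFrom_of_step_eq_pure (by rw [step, hi]), succFrom_of_step_eq_pure (by rw [step, hQ]),
      h.reg, h.mem]
    exact h.succFrom_put_le hW' ih _ _ _
  | store x y next =>
    refine le_trans ?_ hmono
    have hQ : (P.clocked L p q C).code c.pc =
        .store (simReg x) (simReg y) (bodyLabel next (.inl 0)) := by rw [hcode, hi]; rfl
    rw [succFrom_of_step_eq_pure (by rw [step, hi]), succFrom_of_step_eq_pure (by rw [step, hQ])]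
    exact ih _ _ (h.store x y _ _) rfl
  | branch x y yes no =>
    refine le_trans ?_ hmono
    have hQ : (P.clocked L p q C).code c.pc = .branch (simReg x) (simReg y)
        (bodyLabel yes (.inl 0)) (bodyLabel no (.inl 0)) := by rw [hcode, hi]; rfl
    rw [succFrom_of_step_eq_pure (by rw [step, hi]), succFrom_of_step_eq_pure (by rw [step, hQ])]
    refine ih _ _ (h.jump _ _) ?_
    simp only [h.reg]
    split_ifs <;> rfl
  | rand r x next =>
    refine le_trans ?_ hmono
    have hQ : (P.clocked L p q C).code c.pc =
        .rand (simReg r) (simReg x) (bodyLabel next (.inl 0)) := by rw [hcode, hi]; rfl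
    rw [succFrom_rand hi, succFrom_rand hQ, h.reg]
    exact ENNReal.tsum_le_tsum fun v => by
      gcongr
      exact h.succFrom_put_le hW' ih _ _ _
  | query r x y next =>
    rw [succFrom_of_step_eq_pure (by rw [step, hi])]
    obtain ⟨j, hj, c', h', hr, hstep⟩ := h.reaches_query (adj := adj) hW hn hm hi hpc
    refine le_trans ?_ (hr.succFrom_le (k := k' + 1) (by omega))
    rw [succFrom_of_step_eq_pure hstep]
    exact h'.succFrom_put_le hW' ih _ _ _
  | halt => exact absurd hi hd

/-- Once halted, the simulated program succeeds with probability 0 or 1, depending on its memory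
alone. One step leads to the output routine, which takes three more. -/
theorem Simulates.succFrom_le_of_halt {good : (ℕ → ℕ) → Prop} {v : ℕ}
    (hgood : ∀ mem, good mem → (if mem 0 = 0 then 0 else 1) = v) (h : Simulates W n m z c d)
    (hpc : c.pc = bodyLabel d.pc (.inl 0)) (hW : 0 < W) (hd : P.code d.pc = .halt) (k : ℕ)
    {k' : ℕ} (hk' : 4 ≤ k') :
    P.succFrom (blowUpEntry L n m adj) W' good k (some d) ≤
      (P.clocked L p q C).succFrom adj W (fun mem => mem 0 = v) k' (some c) := by
  classical
  rw [succFrom_halt hd]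
  split_ifs with hg
  swap
  · exact zero_le
  have h0 : (P.clocked L p q C).code c.pc = .lit (ctlReg .aux) 0 (finishLabel 0) := by
    rw [hpc, code_bodyLabel, hd]; rfl
  have h' : Simulates W n m z
      ⟨finishLabel 0, Function.update c.reg (ctlReg .aux) 0, c.mem⟩ d := by
    obtain ⟨h1, h2, h3, h4, h5, h6, h7, h8, h9, h10, h11, h12, h13⟩ := h
    constructor <;> simp [*]
  refine le_trans ?_ (Reaches.succFrom_le (k := 3) (.lit h0 hW (.refl _)) hk')
  rw [← hgood _ hg]
  exact h'.one_le_succFrom_finish rfl le_rfl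

/-- The simulating program succeeds at least as often as `P`, as long as there is enough time on
the clock or the right answer is that of a program that has run out of time. -/
theorem Simulates.succFrom_le {good : (ℕ → ℕ) → Prop} {v : ℕ}
    (hgood : ∀ mem, good mem → (if mem 0 = 0 then 0 else 1) = v) (hW' : W' ≤ W)
    (hW : n + m + n < W) (hn : 0 < n) (hm : 0 < m) (h : Simulates W n m z c d) (hz : z < W)
    (hpc : c.pc = bodyLabel d.pc (.inl 0)) (k : ℕ) (hv : v = 0 ∨ k ≤ z) :
    P.succFrom (blowUpEntry L n m adj) W' good k (some d) ≤
      (P.clocked L p q C).succFrom adj W (fun mem => mem 0 = v) (25 * (z + 1)) (some c) := by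
  induction z generalizing k c d with
  | zero =>
    by_cases hd : P.code d.pc = .halt
    · exact h.succFrom_le_of_halt hgood hpc (by omega) hd k (by omega)
    -- The clock is empty: either giving up produces the right answer 0, or the simulated program
    -- has no steps left and has not halted, hence has probability 0.
    rcases hv with rfl | hk
    · have h0 : (P.clocked L p q C).code (bodyLabel d.pc (.inl 0)) = .branch (ctlReg .zero)
          (ctlReg .clock) (bodyLabel d.pc (.inl 1)) (finishLabel 3) := by
        rw [code_bodyLabel]
        cases hcode : P.code d.pc <;> first | exact absurd hcode hd | rfl
      rw [← hpc] at h0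
      refine (succFrom_le_one _ _).trans (le_trans ?_ (Reaches.succFrom_le (k := 1)
        (.branch_no h0 (by rw [h.zero, h.clock]; omega) (.refl _)) (by omega)))
      exact (h.jump (finishLabel 3) d.pc).one_le_succFrom_giveUp rfl le_rfl
    · obtain rfl : k = 0 := by omega
      rw [succFrom_zero_of_not_halt hd]
      exact zero_le
  | succ z ih =>
    by_cases hd : P.code d.pc = .halt
    · exact h.succFrom_le_of_halt hgood hpc (by omega) hd k (by omega)
    cases k with
    | zero =>
      rw [succFrom_zero_of_not_halt hd]
      exact zero_le
    | succ k =>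
      obtain ⟨c', h', hpc', hr⟩ := h.tick (adj := adj) (by omega) hpc hd
      -- Two steps for the tick and eleven for the instruction stay within the 25 allotted to one
      -- unit of the clock.
      refine le_trans (h'.succFrom_exec_le hW' hW hn hm ?_ hpc' hd)
        (hr.succFrom_le (k := 25 * (z + 1) + 11) (by omega))
      exact fun c d h hpc => ih h (by omega) hpc k (hv.imp id fun h => by omega)

end

end RAMProgram

/-! ### Computing the clock and preparing the input. -/

/-- The number of binary digits of `n`. -/
def bitLength (n : ℕ) : ℕ := if n = 0 then 0 else Nat.log 2 n + 1

/-- This is the recursion of the halving loop. It holds at `n = 1` because zero is given no digits.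
-/
theorem bitLength_of_pos {n : ℕ} (hn : 0 < n) : bitLength n = bitLength (n / 2) + 1 := by
  unfold bitLength
  rcases Nat.lt_or_ge n 2 with h | h
  · obtain rfl : n = 1 := by omega
    simp
  · rw [if_neg (by omega), if_neg (by omega), Nat.log_of_one_lt_of_le (by norm_num) h]

namespace RAMProgram

variable {P : RAMProgram} {L p q C : ℕ}

section
variable {W n m z : ℕ} {adj : ℕ → ℕ → ℕ} {c : (P.clocked L p q C).Config} {d : P.Config}

open Classical in
theorem Simulates.update_clock (h : Simulates W n m z c d) (z' : ℕ)
    (pc : (P.clocked L p q C).Label) :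
    Simulates W n m z' ⟨pc, Function.update c.reg (ctlReg .clock) z', c.mem⟩ d := by
  obtain ⟨h1, h2, h3, h4, h5, h6, h7, h8, h9, h10, h11, h12, h13⟩ := h
  constructor <;> simp [*]

open Classical in
theorem Simulates.update_aux (h : Simulates W n m z c d) (v : ℕ)
    (pc : (P.clocked L p q C).Label) :
    Simulates W n m z ⟨pc, Function.update c.reg (ctlReg .aux) v, c.mem⟩ d := by
  obtain ⟨h1, h2, h3, h4, h5, h6, h7, h8, h9, h10, h11, h12, h13⟩ := h
  constructor <;> simp [*]

/-- The loop that multiplies `p` by a number of binary digits. -/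
theorem Simulates.reaches_loop (x : ℕ) (h : Simulates W n m z c d) (hpc : c.pc = setupLabel 13)
    (hx : c.reg (ctlReg (.tmp false)) = x) (h2 : c.reg (ctlReg (.tmp true)) = 2)
    (hp : c.reg (ctlReg .aux) = p) (hxW : x < W) (hW : z + p * bitLength x < W) :
    ∃ c', Simulates W n m (z + p * bitLength x) c' d ∧ c'.pc = setupLabel 16 ∧
      Reaches (P.clocked L p q C) adj W (3 * bitLength x + 1) c c' := by
  classical
  have h13 : (P.clocked L p q C).code (setupLabel 13) = .branch (ctlReg .zero)
    (ctlReg (.tmp false)) (setupLabel 14) (setupLabel 16) := rfl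
  have h14 : (P.clocked L p q C).code (setupLabel 14) = .op .div (ctlReg (.tmp false))
    (ctlReg (.tmp false)) (ctlReg (.tmp true)) (setupLabel 15) := rfl
  have h15 : (P.clocked L p q C).code (setupLabel 15) = .op .add (ctlReg .clock)
    (ctlReg .clock) (ctlReg .aux) (setupLabel 13) := rfl
  rw [← hpc] at h13
  induction x using Nat.strong_induction_on generalizing c z with
  | _ x ih =>
    rcases Nat.eq_zero_or_pos x with rfl | hpos
    · exact ⟨⟨setupLabel 16, c.reg, c.mem⟩, h.jump _ d.pc, rfl,
        .branch_no h13 (by rw [h.zero, hx]; omega) (.refl _)⟩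
    · have hb := bitLength_of_pos hpos
      rw [hb] at hW ⊢
      have hW' : z + p + p * bitLength (x / 2) < W := by
        rw [mul_add, mul_one] at hW; omega
      have hlt : x / 2 < x := by omega
      have s := (h.update_tmp false (x / 2) (setupLabel 15)).update_clock (z + p) (setupLabel 13)
      obtain ⟨c', h', hpc', hr⟩ := ih (x / 2) hlt s rfl (by simp) (by simp [h2]) (by simp [hp])
        (by omega) hW' rfl
      refine ⟨c', by convert h' using 1; ring, hpc', ?_⟩
      rw [show 3 * (bitLength (x / 2) + 1) + 1 = 3 * bitLength (x / 2) + 1 + 1 + 1 + 1 by ring]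
      refine .branch_yes h13 (by rw [h.zero, hx]; exact hpos) (.op h14 ?_ (.op h15 ?_ ?_))
      · simp only [WordOp.eval, hx, h2]; omega
      · simp [WordOp.eval, h.clock, hp]; omega
      · simpa [WordOp.eval, h.clock, hp, hx, h2] using hr

/-- The preparation of the input and of the clock. -/
theorem exists_reaches_setup (hW : L * n + L * n + L * n < W) (hnm : n + m < W) (hLW : L < W)
    (hpW : p < W) (hqW : q < W) (hCW : C < W) (h2W : 2 < W) (hpl : p * bitLength n < W)
    (hT : C <<< (p * bitLength n / q) < W) :
    ∃ j ≤ 3 * bitLength n + 18, ∃ c',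
      Simulates W n m (C <<< (p * bitLength n / q)) c' (P.init [L * n + L * n + L * n]) ∧
      c'.pc = bodyLabel (P.init [L * n + L * n + L * n]).pc (.inl 0) ∧
      Reaches (P.clocked L p q C) adj W j ((P.clocked L p q C).init [n, m]) c' := by
  classical
  have hA : ∃ c', (Simulates W n m 0 c' (P.init [L * n + L * n + L * n]) ∧
      c'.pc = setupLabel 13 ∧ c'.reg (ctlReg (.tmp false)) = n ∧
      c'.reg (ctlReg (.tmp true)) = 2 ∧ c'.reg (ctlReg .aux) = p) ∧
      Reaches (P.clocked L p q C) adj W 13 ((P.clocked L p q C).init [n, m]) c' := by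
    have h0 : (P.clocked L p q C).code ((P.clocked L p q C).init [n, m]).pc =
      .lit (ctlReg .one) 1 (setupLabel 1) := rfl
    have h1 : (P.clocked L p q C).code (setupLabel 1) =
      .load (ctlReg .n) (ctlReg .zero) (setupLabel 2) := rfl
    have h2 : (P.clocked L p q C).code (setupLabel 2) =
      .load (ctlReg .m) (ctlReg .one) (setupLabel 3) := rfl
    have h3 : (P.clocked L p q C).code (setupLabel 3) =
      .store (ctlReg .one) (ctlReg .zero) (setupLabel 4) := rfl
    have h4 : (P.clocked L p q C).code (setupLabel 4) =
      .op .add (ctlReg .nm) (ctlReg .n) (ctlReg .m) (setupLabel 5) := rfl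
    have h5 : (P.clocked L p q C).code (setupLabel 5) =
      .lit (ctlReg .aux) L (setupLabel 6) := rfl
    have h6 : (P.clocked L p q C).code (setupLabel 6) =
      .op .mul (ctlReg .ln) (ctlReg .aux) (ctlReg .n) (setupLabel 7) := rfl
    have h7 : (P.clocked L p q C).code (setupLabel 7) =
      .op .add (ctlReg .lln) (ctlReg .ln) (ctlReg .ln) (setupLabel 8) := rfl
    have h8 : (P.clocked L p q C).code (setupLabel 8) =
      .op .add (ctlReg .size) (ctlReg .lln) (ctlReg .ln) (setupLabel 9) := rfl
    have h9 : (P.clocked L p q C).code (setupLabel 9) =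
      .store (ctlReg .zero) (ctlReg .size) (setupLabel 10) := rfl
    have h10 : (P.clocked L p q C).code (setupLabel 10) =
      .op .add (ctlReg (.tmp false)) (ctlReg .n) (ctlReg .zero) (setupLabel 11) := rfl
    have h11 : (P.clocked L p q C).code (setupLabel 11) =
      .lit (ctlReg (.tmp true)) 2 (setupLabel 12) := rfl
    have h12 : (P.clocked L p q C).code (setupLabel 12) =
      .lit (ctlReg .aux) p (setupLabel 13) := rfl
    refine ⟨_, ?_, .lit h0 ?_ (.load h1 ?_ (.load h2 ?_ (.store h3 (.op h4 ?_ (.lit h5 ?_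
      (.op h6 ?_ (.op h7 ?_ (.op h8 ?_ (.store h9 (.op h10 ?_ (.lit h11 ?_ (.lit h12 ?_
      (.refl _)))))))))))))⟩
    · refine ⟨?_, rfl, ?_, ?_, ?_⟩
      · constructor
        case mem =>
          funext a
          rcases a with _ | _ | a <;> simp [init, WordOp.eval]
        case mem_lt =>
          intro a
          rcases a with _ | a <;> simp [init] <;> omega
        all_goals simp [init, WordOp.eval]
        omega
      all_goals simp [init, WordOp.eval]
    all_goals try simp [init, WordOp.eval]
    all_goals omega
  obtain ⟨c1, ⟨s1, hpc1, hx, htwo, hp⟩, r1⟩ := hA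
  obtain ⟨c2, s2, hpc2, r2⟩ := s1.reaches_loop (adj := adj) n hpc1 hx htwo hp (by omega)
    (by omega)
  rw [zero_add] at s2
  have h16 : (P.clocked L p q C).code (setupLabel 16) =
    .lit (ctlReg .aux) q (setupLabel 17) := rfl
  have h17 : (P.clocked L p q C).code (setupLabel 17) =
    .op .div (ctlReg .clock) (ctlReg .clock) (ctlReg .aux) (setupLabel 18) := rfl
  have h18 : (P.clocked L p q C).code (setupLabel 18) =
    .lit (ctlReg .aux) C (setupLabel 19) := rfl
  have h19 : (P.clocked L p q C).code (setupLabel 19) =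
    .op .shl (ctlReg .clock) (ctlReg .aux) (ctlReg .clock) (bodyLabel P.start (.inl 0)) := rfl
  rw [← hpc2] at h16
  have s3 := (((s2.update_aux q (setupLabel 17)).update_clock (p * bitLength n / q)
    (setupLabel 18)).update_aux C (setupLabel 19)).update_clock (C <<< (p * bitLength n / q))
    (bodyLabel P.start (.inl 0))
  refine ⟨13 + ((3 * bitLength n + 1) + 4), by omega, _, s3, rfl, r1.trans (r2.trans
    (.lit h16 hqW (.op h17 ?_ (.lit h18 hCW (.op h19 ?_ ?_)))))⟩
  · simp [WordOp.eval, s2.clock]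
    exact (Nat.div_le_self _ _).trans_lt hpl
  · simpa [WordOp.eval, s2.clock] using hT
  · simp [WordOp.eval, s2.clock]
    exact .refl _

/-- The simulating program succeeds at least as often as `P` does on the blow-up. -/
theorem successProb_le_clocked {W' : ℕ} {good : (ℕ → ℕ) → Prop} {v : ℕ}
    (hgood : ∀ mem, good mem → (if mem 0 = 0 then 0 else 1) = v) (hW' : W' ≤ W)
    (hnW : n + m + n < W) (hn : 0 < n) (hm : 0 < m) (hW : L * n + L * n + L * n < W)
    (hLW : L < W) (hpW : p < W) (hqW : q < W) (hCW : C < W) (h2W : 2 < W)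
    (hpl : p * bitLength n < W) (hT : C <<< (p * bitLength n / q) < W) (k : ℕ)
    (hv : v = 0 ∨ k ≤ C <<< (p * bitLength n / q)) :
    P.successProb (blowUpEntry L n m adj) W' [L * n + L * n + L * n] k good ≤
      (P.clocked L p q C).successProb adj W [n, m]
        (25 * (C <<< (p * bitLength n / q) + 1) + (3 * bitLength n + 18))
        (fun mem => mem 0 = v) := by
  obtain ⟨j, hj, c', s, hpc, r⟩ := exists_reaches_setup (P := P) (adj := adj) (m := m) hW
    (by omega) hLW hpW hqW hCW h2W hpl hT
  rw [successProb_eq_succFrom, successProb_eq_succFrom]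
  exact (s.succFrom_le hgood hW' hnW hn hm hT hpc k hv).trans (r.succFrom_le (by omega))

end

end RAMProgram

/-! ### Blow-ups of tripartite graphs -/

theorem blowUpVertex_lt {n m : ℕ} (L : ℕ) (hn : 0 < n) (hm : 0 < m) (v : ℕ) :
    blowUpVertex L n m v < n + m + n := by
  have h1 := Nat.mod_lt v hn
  have h2 := Nat.mod_lt v hm
  unfold blowUpVertex
  split_ifs <;> omega

section
variable {n m : ℕ} (L : ℕ) (hn : 0 < n) (hm : 0 < m) (G : SimpleGraph (Fin (n + m + n)))

/-- The blow-up of a graph. -/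
def blowUp : SimpleGraph (Fin (L * n + L * n + L * n)) :=
  G.comap fun v => ⟨blowUpVertex L n m v, blowUpVertex_lt L hn hm v⟩

/-- This identifies what the simulator answers to queries with the input matrix of a genuine graph,
to which the assumption on the approximation program applies. -/
theorem adjEntry_blowUp :
    adjEntry (blowUp L hn hm G) = blowUpEntry L n m (adjEntry G) := by
  funext x y
  unfold blowUpEntry adjEntry
  by_cases hx : x < L * n + L * n + L * n
  · by_cases hy : y < L * n + L * n + L * n
    · have hxy : x < L * n + L * n + L * n ∧ y < L * n + L * n + L * n := ⟨hx, hy⟩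
      rw [if_pos hxy]
      congr 1
      simp only [hx, hy, blowUp, blowUpVertex_lt L hn hm, SimpleGraph.comap_adj, exists_true_left]
    · simp [hy]
  · simp [hx]

/-- Sending a copy to its original is a graph homomorphism, and the image of a triangle is a
triangle. -/
theorem triangleCount_blowUp_of_cliqueFree (h : G.CliqueFree 3) :
    triangleCount (blowUp L hn hm G) = 0 := by
  have : (blowUp L hn hm G).cliqueSet 3 = ∅ := by
    rw [SimpleGraph.cliqueSet_eq_empty_iff]
    intro s hs
    obtain ⟨a, b, c, hab, hac, hbc, -⟩ := SimpleGraph.is3Clique_iff.1 hs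
    exact h _ (SimpleGraph.is3Clique_triple_iff.2 ⟨hab, hac, hbc⟩)
  rw [triangleCount, this, Set.ncard_empty]

variable {G}

theorem exists_triangle_of_isTripartite (hG : IsTripartite n m G) (h : ¬ G.CliqueFree 3) :
    ∃ x y z : Fin (n + m + n), (x : ℕ) < n ∧ (n ≤ (y : ℕ) ∧ (y : ℕ) < n + m) ∧
      n + m ≤ (z : ℕ) ∧ G.Adj x y ∧ G.Adj x z ∧ G.Adj y z := by
  simp only [SimpleGraph.CliqueFree, not_forall, not_not] at h
  obtain ⟨s, hs⟩ := h
  obtain ⟨a, b, c, hab, hac, hbc, -⟩ := SimpleGraph.is3Clique_iff.1 hs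
  have key : ∀ v : Fin (n + m + n),
      (tripartPart n m v = 0 ∧ (v : ℕ) < n) ∨
      (tripartPart n m v = 1 ∧ n ≤ (v : ℕ) ∧ (v : ℕ) < n + m) ∨
      (tripartPart n m v = 2 ∧ n + m ≤ (v : ℕ)) := by
    intro v
    unfold tripartPart
    split_ifs <;> simp <;> omega
  have h1 := hG _ _ hab
  have h2 := hG _ _ hac
  have h3 := hG _ _ hbc
  rcases key a with ⟨ea, ha⟩ | ⟨ea, ha⟩ | ⟨ea, ha⟩ <;>
  rcases key b with ⟨eb, hb⟩ | ⟨eb, hb⟩ | ⟨eb, hb⟩ <;>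
  rcases key c with ⟨ec, hc⟩ | ⟨ec, hc⟩ | ⟨ec, hc⟩ <;>
  simp only [ea, eb, ec, ne_eq, not_true] at h1 h2 h3
  · exact ⟨a, b, c, ha, hb, hc, hab, hac, hbc⟩
  · exact ⟨a, c, b, ha, hc, hb, hac, hab, hbc.symm⟩
  · exact ⟨b, a, c, hb, ha, hc, hab.symm, hbc, hac⟩
  · exact ⟨c, a, b, hc, ha, hb, hac.symm, hbc.symm, hab⟩
  · exact ⟨b, c, a, hb, hc, ha, hbc, hab.symm, hac.symm⟩
  · exact ⟨c, b, a, hc, hb, ha, hbc.symm, hac.symm, hab.symm⟩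

/-- One copy of the vertex in the first part is kept fixed, while `L` copies of the last vertex and
`L * n / m` copies of the middle one vary independently. The further factor from copies of the first
vertex is not needed. -/
theorem le_triangleCount_blowUp (hL : 0 < L) (hG : IsTripartite n m G) (h : ¬ G.CliqueFree 3) :
    L * (L * n / m) ≤ triangleCount (blowUp L hn hm G) := by
  classical
  obtain ⟨x, y, z, hx, hy, hz, hxy, hxz, hyz⟩ := exists_triangle_of_isTripartite hG h
  have hLn : n ≤ L * n := Nat.le_mul_of_pos_left n hL
  have hz' := z.2
  have hmul : ∀ i < L, i * n + n ≤ L * n := fun i hi => by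
    have := Nat.mul_le_mul_right n (Nat.succ_le_of_lt hi)
    rwa [Nat.succ_mul] at this
  have hmul' : ∀ k < L * n / m, k * m + m ≤ L * n := fun k hk => by
    have := Nat.mul_le_mul_right m (Nat.succ_le_of_lt hk)
    rw [Nat.succ_mul] at this
    exact this.trans (Nat.div_mul_le_self _ _)
  let f : Fin L × Fin (L * n / m) → Finset (Fin (L * n + L * n + L * n)) := fun u =>
    {⟨u.2 * m + (y - n), by have := hmul' u.2 u.2.2; omega⟩,
      ⟨L * n + x, by omega⟩,
      ⟨L * n + L * n + (u.1 * n + (z - (n + m))), by have := hmul u.1 u.1.2; omega⟩}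
  have hf : ∀ u, f u ∈ (blowUp L hn hm G).cliqueSet 3 := by
    rintro ⟨i, k⟩
    have h1 := hmul i i.2
    have h2 := hmul' k k.2
    -- Residues modulo `n` need no correction, as the second and third block start at multiples of
    -- `n`. Copies of the middle part come first because `L * n` need not be a multiple of `m`.
    have e1 : blowUpVertex L n m (k * m + (y - n)) = y := by
      rw [blowUpVertex, if_pos (by omega), Nat.mul_add_mod_of_lt (by omega)]
      omega
    have e2 : blowUpVertex L n m (L * n + x) = x := by
      rw [blowUpVertex, if_neg (by omega), if_pos (by omega), Nat.mul_add_mod_of_lt hx]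
    have e3 : blowUpVertex L n m (L * n + L * n + (i * n + (z - (n + m)))) = z := by
      rw [blowUpVertex, if_neg (by omega), if_neg (by omega),
        show L * n + L * n + (i * n + (z - (n + m))) = (L + L + i) * n + (z - (n + m)) by ring,
        Nat.mul_add_mod_of_lt (by omega)]
      omega
    rw [SimpleGraph.mem_cliqueSet_iff, SimpleGraph.is3Clique_triple_iff]
    simp only [blowUp, SimpleGraph.comap_adj, e1, e2, e3]
    exact ⟨hxy.symm, hyz, hxz⟩
  have hinj : Function.Injective f := by
    rintro ⟨i, k⟩ ⟨i', k'⟩ h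
    have h1 := hmul i i.2
    have h2 := hmul' k k.2
    have h1' := hmul i' i'.2
    have h2' := hmul' k' k'.2
    have hk : (⟨k * m + (y - n), by omega⟩ : Fin (L * n + L * n + L * n)) ∈ f (i', k') := by
      rw [← h]; simp [f]
    have hi : (⟨L * n + L * n + (i * n + (z - (n + m))), by omega⟩ :
        Fin (L * n + L * n + L * n)) ∈ f (i', k') := by
      rw [← h]; simp [f]
    simp only [f, Finset.mem_insert, Finset.mem_singleton, Fin.mk.injEq] at hk hi
    -- The three vertices of each triangle lie in different blocks, so a vertex can only coincide
    -- with the one from its own block.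
    have ek : (k : ℕ) * m = k' * m := by omega
    have ei : (i : ℕ) * n = i' * n := by omega
    exact Prod.ext (Fin.ext (Nat.eq_of_mul_eq_mul_right hn ei))
      (Fin.ext (Nat.eq_of_mul_eq_mul_right hm ek))
  have hcard := Set.ncard_le_ncard (s := Set.range f) (t := (blowUp L hn hm G).cliqueSet 3)
    (by rintro _ ⟨u, rfl⟩; exact hf u) (Set.toFinite _)
  rw [← Set.image_univ, Set.ncard_image_of_injective _ hinj, Set.ncard_univ, Nat.card_prod,
    Nat.card_fin, Nat.card_fin] at hcard
  exact hcard

end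

/-! ### The bounds on the clock, the words and the number of triangles -/

/-- A multiplicative error leaves no slack at zero, and the denominator is nonzero, so the numerator
vanishes. -/
theorem IsApproxOutput.verdict_of_zero {ε : ℝ} {mem : ℕ → ℕ} (h : IsApproxOutput ε 0 mem) :
    (if mem 0 = 0 then 0 else 1) = 0 := by
  obtain ⟨h1, h2, h3⟩ := h
  simp only [Nat.cast_zero, mul_zero] at h2 h3
  have h4 := le_antisymm h3 h2
  rw [div_eq_zero_iff] at h4
  simp only [Nat.cast_eq_zero, h1, or_false] at h4
  simp [h4]

theorem IsApproxOutput.verdict_of_pos {ε : ℝ} (hε : ε < 1) {t : ℕ} (ht : 0 < t) {mem : ℕ → ℕ}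
    (h : IsApproxOutput ε t mem) : (if mem 0 = 0 then 0 else 1) = 1 := by
  obtain ⟨h1, h2, h3⟩ := h
  have : (0 : ℝ) < (1 - ε) * t := mul_pos (by linarith) (by exact_mod_cast ht)
  rw [if_neg]
  intro h0
  simp only [h0, Nat.cast_zero, zero_div] at h2
  linarith

theorem lt_two_pow_bitLength (n : ℕ) : n < 2 ^ bitLength n := by
  unfold bitLength
  split_ifs with h
  · simp [h]
  · exact Nat.lt_pow_succ_log_self (by norm_num) n

theorem bitLength_eq {n : ℕ} (hn : 1 ≤ n) : bitLength n = Nat.log 2 n + 1 :=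
  if_neg (by omega)

theorem two_pow_bitLength_le {n : ℕ} (hn : 1 ≤ n) : 2 ^ bitLength n ≤ 2 * n := by
  rw [bitLength_eq hn, pow_succ, mul_comm]
  exact Nat.mul_le_mul_left 2 (Nat.pow_log_le_self 2 (by omega))

/-- The number of digits exceeds the binary logarithm of `n`, and rounding the exponent down costs
at most a factor 2. Together with `two_pow_le_rpow`, this makes the clock equal to `n ^ (p / q)` up
to constants. -/
theorem rpow_le_two_mul_two_pow {p q : ℕ} (hq : 0 < q) (n : ℕ) :
    (n : ℝ) ^ ((p : ℝ) / q) ≤ 2 * 2 ^ (p * bitLength n / q) := by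
  have hq' : (0 : ℝ) < q := by exact_mod_cast hq
  have h1 : (n : ℝ) ≤ (2 : ℝ) ^ (bitLength n : ℝ) := by
    rw [Real.rpow_natCast]; exact_mod_cast (lt_two_pow_bitLength n).le
  calc (n : ℝ) ^ ((p : ℝ) / q) ≤ ((2 : ℝ) ^ (bitLength n : ℝ)) ^ ((p : ℝ) / q) :=
        Real.rpow_le_rpow (by positivity) h1 (by positivity)
    _ = (2 : ℝ) ^ ((bitLength n : ℝ) * ((p : ℝ) / q)) := by
        rw [← Real.rpow_mul (by norm_num)]
    _ ≤ (2 : ℝ) ^ (((p * bitLength n / q + 1 : ℕ)) : ℝ) := by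
        refine Real.rpow_le_rpow_of_exponent_le (by norm_num) ?_
        rw [← mul_div_assoc, div_le_iff₀ hq']
        have := Nat.lt_div_mul_add (a := p * bitLength n) hq
        have h2 : bitLength n * p ≤ (p * bitLength n / q + 1) * q := by
          rw [add_mul, one_mul, mul_comm (bitLength n)]; exact this.le
        exact_mod_cast h2
    _ = 2 * 2 ^ (p * bitLength n / q) := by rw [Real.rpow_natCast, pow_succ, mul_comm]

theorem two_pow_le_rpow {p q n : ℕ} (hq : 0 < q) (hn : 1 ≤ n) :
    (2 : ℝ) ^ (p * bitLength n / q) ≤ 2 ^ ((p : ℝ) / q) * (n : ℝ) ^ ((p : ℝ) / q) := by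
  have hq' : (0 : ℝ) < q := by exact_mod_cast hq
  have h1 : (2 : ℝ) ^ (bitLength n : ℝ) ≤ 2 * n := by
    rw [Real.rpow_natCast]; exact_mod_cast two_pow_bitLength_le hn
  rw [← Real.mul_rpow (by norm_num) (by positivity)]
  calc (2 : ℝ) ^ (p * bitLength n / q) = (2 : ℝ) ^ (((p * bitLength n / q : ℕ)) : ℝ) := by
        rw [Real.rpow_natCast]
    _ ≤ (2 : ℝ) ^ ((bitLength n : ℝ) * ((p : ℝ) / q)) := by
        refine Real.rpow_le_rpow_of_exponent_le (by norm_num) ?_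
        rw [← mul_div_assoc, mul_comm (bitLength n : ℝ)]
        exact_mod_cast Nat.cast_div_le (α := ℝ) (m := p * bitLength n) (n := q)
    _ = ((2 : ℝ) ^ (bitLength n : ℝ)) ^ ((p : ℝ) / q) := by
        rw [← Real.rpow_mul (by norm_num)]
    _ ≤ (2 * n : ℝ) ^ ((p : ℝ) / q) :=
        Real.rpow_le_rpow (by positivity) h1 (by positivity)

/-- The setup takes time linear in the number of digits; as `p` is positive, the clock dominates it.
-/
theorem le_mul_two_pow_div {p q : ℕ} (hp : 0 < p) (hq : 0 < q) (l : ℕ) :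
    l ≤ q * 2 ^ (p * l / q) := by
  have h1 : l ≤ p * l := Nat.le_mul_of_pos_left l hp
  have h2 := Nat.lt_div_mul_add (a := p * l) hq
  have h3 : (p * l / q + 1) * q ≤ 2 ^ (p * l / q) * q :=
    Nat.mul_le_mul_right q (Nat.lt_two_pow_self)
  rw [add_mul, one_mul] at h3
  rw [mul_comm q]
  omega

theorem lt_two_pow_mul {x e l : ℕ} (h : x ≤ e) (hl : 1 ≤ l) : x < 2 ^ (e * l) :=
  Nat.lt_two_pow_self.trans_le
    (Nat.pow_le_pow_right (by norm_num) (h.trans (Nat.le_mul_of_pos_right e hl)))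

theorem mul_lt_two_pow_mul {x n e : ℕ} (hn : 1 ≤ n) (h : x + 1 ≤ e) :
    x * n < 2 ^ (e * bitLength n) := by
  have hl : 1 ≤ bitLength n := by rw [bitLength_eq hn]; omega
  calc x * n < 2 ^ x * 2 ^ bitLength n :=
        Nat.mul_lt_mul_of_lt_of_le Nat.lt_two_pow_self (lt_two_pow_bitLength n).le (by positivity)
    _ = 2 ^ (x + bitLength n) := (pow_add _ _ _).symm
    _ ≤ 2 ^ (e * bitLength n) := by
        refine Nat.pow_le_pow_right (by norm_num) ?_
        calc x + bitLength n ≤ x * bitLength n + bitLength n := by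
              gcongr; exact Nat.le_mul_of_pos_right x hl
          _ = (x + 1) * bitLength n := by ring
          _ ≤ e * bitLength n := by gcongr

/-- Enlarging the vertex set by a constant factor adds only constantly many bits, so a larger
constant in the word size accommodates the simulated program. -/
theorem wordBound_mul_le {c x n e : ℕ} (hx : 1 ≤ x) (hn : 1 ≤ n) (h : c * (x + 1) ≤ e) :
    wordBound c (x * n) ≤ 2 ^ (e * bitLength n) := by
  refine Nat.pow_le_pow_right (by norm_num) ?_
  have hlog : Nat.log 2 (x * n) < (x + 1) * bitLength n :=
    Nat.log_lt_of_lt_pow (by positivity) (mul_lt_two_pow_mul hn le_rfl)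
  calc c * (Nat.log 2 (x * n) + 1) ≤ c * ((x + 1) * bitLength n) := by gcongr; omega
    _ = c * (x + 1) * bitLength n := by ring
    _ ≤ e * bitLength n := by gcongr

/-- With `m = powDim n b ≤ n ^ b`, the threshold is at most `3 * κ * L * (n / m)`. The count is at
least `L * (L - 1) * (n / m)`, so `L - 1 ≥ 3 * κ` suffices. -/
theorem threshold_le {b κ : ℝ} (hb₀ : 0 ≤ b) (hb₁ : b ≤ 1) (hκ : 0 < κ) {L n : ℕ} (hn : 1 ≤ n)
    (hL : 3 * κ + 1 ≤ L) :
    κ * ((L * n + L * n + L * n : ℕ) : ℝ) ^ (1 - b) ≤ ((L * (L * n / powDim n b) : ℕ) : ℝ) := by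
  have hn' : (1 : ℝ) ≤ n := by exact_mod_cast hn
  have hL1 : (1 : ℝ) ≤ L := by linarith
  have hm : (1 : ℝ) ≤ (powDim n b : ℕ) := by exact_mod_cast powDim_pos hn hb₀
  have hmn : ((powDim n b : ℕ) : ℝ) ≤ n := by exact_mod_cast powDim_le_self hn hb₁
  have hmb : ((powDim n b : ℕ) : ℝ) ≤ (n : ℝ) ^ b := Nat.floor_le (by positivity)
  have h1 : (n : ℝ) ^ (1 - b) ≤ n / powDim n b := by
    rw [Real.rpow_sub (by linarith), Real.rpow_one]
    gcongr
  have h2 : ((L * n + L * n + L * n : ℕ) : ℝ) ^ (1 - b) ≤ 3 * L * (n / powDim n b) := by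
    have : ((L * n + L * n + L * n : ℕ) : ℝ) = 3 * L * n := by push_cast; ring
    rw [this, Real.mul_rpow (by positivity) (by positivity)]
    gcongr
    calc (3 * L : ℝ) ^ (1 - b) ≤ (3 * L : ℝ) ^ (1 : ℝ) :=
          Real.rpow_le_rpow_of_exponent_le (by linarith) (by linarith)
      _ = 3 * L := Real.rpow_one _
  have h3 : (L : ℝ) * (n / powDim n b) - 1 ≤ ((L * n / powDim n b : ℕ) : ℝ) := by
    have := Nat.lt_div_mul_add (a := L * n) (powDim_pos hn hb₀)
    have h4 : (L * n : ℝ) < ((L * n / powDim n b : ℕ) : ℝ) * (powDim n b : ℕ) + (powDim n b : ℕ) :=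
      by exact_mod_cast this
    rw [← mul_div_assoc, sub_le_iff_le_add, div_le_iff₀ (by linarith)]
    linarith
  -- This absorbs the loss of 1 from the integer division: it costs one of the `L` multiples of `n /
  -- m`.
  have h5 : 1 ≤ (n : ℝ) / powDim n b := by rwa [le_div_iff₀ (by linarith), one_mul]
  push_cast at h2 h3 ⊢
  have h6 : 3 * κ * (n / powDim n b) ≤ (L - 1) * (n / powDim n b : ℝ) := by gcongr; linarith
  calc κ * ((L * n + L * n + L * n : ℝ)) ^ (1 - b) ≤ κ * (3 * L * (n / powDim n b)) := by gcongr
    _ = L * (3 * κ * (n / powDim n b)) := by ring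
    _ ≤ L * ((L * n / powDim n b : ℕ) : ℝ) := by gcongr; nlinarith

/-! ### Assembling the reduction. -/

theorem MM_rpow (F : Type*) [Field F] (n : ℕ) (a b c s : ℝ) :
    MM F n a b c ^ s = (n : ℝ) ^ (omegaExp F a b c * s) := by
  rw [MM, ← Real.rpow_mul (by positivity)]

/-- A program that approximates the number of triangles yields a program for triangle detection in
unbalanced tripartite graphs. -/
theorem exists_detector {F : Type*} [Field F] {b : ℝ} (hb₀ : 0 ≤ b) (hb₁ : b ≤ 1)
    {ε : ℝ} (hε₁ : ε < 1) {κ : ℝ} (hκ : 0 < κ) {δ δ' : ℝ} (hδ' : 0 < δ') (hδδ' : δ' < δ)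
    (hδ1 : δ' < 1) {P : RAMProgram} {K : ℝ}
    (hP : ApproximatesTriangles P ε (fun n => κ * (n : ℝ) ^ (1 - b))
      (fun n => K * (MM F n 1 b 1) ^ (1 - δ))) :
    ∃ (Q : RAMProgram) (c : ℕ) (K : ℝ), ∀ n : ℕ, 1 ≤ n →
      ∀ G : SimpleGraph (Fin (n + powDim n b + n)), IsTripartite n (powDim n b) G →
        ∃ k : ℕ, (k : ℝ) ≤ K * (MM F n 1 b 1) ^ (1 - δ') ∧
          2 / 3 ≤ Q.successProb (adjEntry G) (wordBound c n) [n, powDim n b] k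
            (DetectsTriangle G) := by
  classical
  obtain ⟨c, hP⟩ := hP
  set ω := omegaExp F 1 b 1 with hω
  have hω2 : 2 ≤ ω := two_le_omegaExp F hb₀ hb₁
  -- a rational exponent that the clock can compute
  obtain ⟨β, hβ1, hβ2⟩ := exists_rat_btwn (show max 0 (ω * (1 - δ)) < ω * (1 - δ') from
    max_lt (mul_pos (by linarith) (by linarith)) (by gcongr))
  -- The exponent is kept positive even if `δ ≥ 1`, so that the clock can pay for the setup.
  have hβ0 : (0 : ℝ) < β := (le_max_left _ _).trans_lt hβ1
  have hβα : ω * (1 - δ) ≤ β := (le_max_right _ _).trans hβ1.le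
  obtain ⟨p, q, hp, hq, hpq⟩ : ∃ p q : ℕ, 0 < p ∧ 0 < q ∧ (p : ℝ) / q = β := by
    have hβ0' : 0 < β := by exact_mod_cast hβ0
    refine ⟨β.num.toNat, β.den, ?_, β.den_pos, ?_⟩
    · have := Rat.num_pos.2 hβ0'
      omega
    · have h : ((β.num.toNat : ℕ) : ℝ) = ((β.num : ℤ) : ℝ) := by
        exact_mod_cast Int.toNat_of_nonneg (Rat.num_pos.2 hβ0').le
      rw [h]
      exact_mod_cast Rat.num_div_den β
  obtain ⟨L, hL⟩ : ∃ L : ℕ, 3 * κ + 1 ≤ L := exists_nat_ge _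
  have hL1 : 1 ≤ L := by
    have : (1 : ℝ) ≤ L := by linarith
    exact_mod_cast this
  -- `C` absorbs the constant of the given time bound, the growth of the vertex set from `n` to `3 *
  -- L * n`, and the factor 2 from rounding the exponent. The absolute value covers negative `K`.
  obtain ⟨C, hC⟩ : ∃ C : ℕ, |K| * (L + L + L : ℝ) ^ (β : ℝ) * 2 ≤ C := exists_nat_ge _
  -- The first summand provides for the words of the simulated program; the others make room for the
  -- program constants, the size of the blow-up and the clock.
  set e := c * (3 * L + 1) + 3 * L + p + q + C + 4 with he
  refine ⟨P.clocked L p q C, e,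
    -- Here `43 = 25 + 18`, and `3 * q` pays for the three steps per digit of the setup loop.
    (25 * C + 3 * q + 43 : ℕ) * 2 ^ (β : ℝ), fun n hn => ?_⟩
  set m := powDim n b with hm
  intro G hG
  have hm1 : 1 ≤ m := powDim_pos hn hb₀
  have hmn : m ≤ n := powDim_le_self hn hb₁
  set T := C <<< (p * bitLength n / q) with hT
  have hTeq : T = C * 2 ^ (p * bitLength n / q) := Nat.shiftLeft_eq _ _
  have hn' : (1 : ℝ) ≤ n := by exact_mod_cast hn
  refine ⟨25 * (T + 1) + (3 * bitLength n + 18), ?_, ?_⟩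
  · have h1 := le_mul_two_pow_div hp hq (bitLength n)
    have h2 : 1 ≤ 2 ^ (p * bitLength n / q) := Nat.one_le_two_pow
    have h3 : 25 * (T + 1) + (3 * bitLength n + 18) ≤
        (25 * C + 3 * q + 43) * 2 ^ (p * bitLength n / q) := by
      rw [hTeq]; nlinarith
    rw [MM_rpow, mul_assoc]
    calc ((25 * (T + 1) + (3 * bitLength n + 18) : ℕ) : ℝ)
        ≤ ((25 * C + 3 * q + 43 : ℕ) : ℝ) * 2 ^ (p * bitLength n / q) := by exact_mod_cast h3
      _ ≤ ((25 * C + 3 * q + 43 : ℕ) : ℝ) * (2 ^ (β : ℝ) * (n : ℝ) ^ (β : ℝ)) := by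
          gcongr
          rw [← hpq]
          exact two_pow_le_rpow hq hn
      _ ≤ _ := by
          gcongr
  have hl : 1 ≤ bitLength n := by rw [bitLength_eq hn]; omega
  have hword : wordBound e n = 2 ^ (e * bitLength n) := by rw [bitLength_eq hn]; rfl
  have hsize : L * n + L * n + L * n = 3 * L * n := by ring
  have hW' : wordBound c (L * n + L * n + L * n) ≤ wordBound e n := by
    rw [hsize, hword]
    exact wordBound_mul_le (by omega) hn (by omega)
  have hTW : T < wordBound e n := by
    rw [hTeq, hword]
    have h1 : p * bitLength n / q ≤ p * bitLength n := Nat.div_le_self _ _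
    calc C * 2 ^ (p * bitLength n / q) < 2 ^ C * 2 ^ (p * bitLength n / q) :=
          Nat.mul_lt_mul_of_pos_right Nat.lt_two_pow_self (by positivity)
      _ = 2 ^ (C + p * bitLength n / q) := (pow_add _ _ _).symm
      _ ≤ 2 ^ (e * bitLength n) := by
          refine Nat.pow_le_pow_right (by norm_num) ?_
          calc C + p * bitLength n / q ≤ C * bitLength n + p * bitLength n := by
                gcongr; exact Nat.le_mul_of_pos_right C hl
            _ = (C + p) * bitLength n := by ring
            _ ≤ e * bitLength n := by gcongr; omega
  have key : ∀ (good : (ℕ → ℕ) → Prop) (v k : ℕ),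
      (∀ mem, good mem → (if mem 0 = 0 then 0 else 1) = v) → (v = 0 ∨ k ≤ T) →
      P.successProb (adjEntry (blowUp L hn hm1 G)) (wordBound c (L * n + L * n + L * n))
        [L * n + L * n + L * n] k good ≤
      (P.clocked L p q C).successProb (adjEntry G) (wordBound e n) [n, m]
        (25 * (T + 1) + (3 * bitLength n + 18)) (fun mem => mem 0 = v) := by
    intro good v k hgood hv
    rw [adjEntry_blowUp]
    refine RAMProgram.successProb_le_clocked hgood hW' ?_ hn hm1 ?_ ?_ ?_ ?_ ?_ ?_ ?_ hTW k hv
    · rw [hword]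
      exact (show n + m + n ≤ 3 * n by omega).trans_lt (mul_lt_two_pow_mul hn (by omega))
    · rw [hword, hsize]
      exact mul_lt_two_pow_mul hn (by omega)
    · rw [hword]; exact lt_two_pow_mul (by omega) hl
    · rw [hword]; exact lt_two_pow_mul (by omega) hl
    · rw [hword]; exact lt_two_pow_mul (by omega) hl
    · rw [hword]; exact lt_two_pow_mul (by omega) hl
    · rw [hword]; exact lt_two_pow_mul (by omega) hl
    · rw [hword]
      exact Nat.lt_two_pow_self.trans_le (Nat.pow_le_pow_right (by norm_num)
        (by gcongr; omega))
  have hN1 : 1 ≤ L * n + L * n + L * n := by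
    have : 0 < L * n := Nat.mul_pos hL1 hn
    omega
  obtain ⟨hfree, hmany⟩ := hP _ hN1 (blowUp L hn hm1 G)
  by_cases hG3 : G.CliqueFree 3
  · have h0 := triangleCount_blowUp_of_cliqueFree L hn hm1 G hG3
    -- Nothing bounds this `k`. That is harmless, because the answer on time-out is the right one
    -- here.
    obtain ⟨k, hk⟩ := hfree h0
    rw [h0] at hk
    have hdet : DetectsTriangle G = fun mem => mem 0 = 0 := by
      funext mem
      simp [DetectsTriangle, hG3]
    rw [hdet]
    exact hk.trans (key _ 0 k (fun mem h => h.verdict_of_zero) (.inl rfl))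
  · have hcount := le_triangleCount_blowUp L hn hm1 hL1 hG hG3
    have hthr : κ * ((L * n + L * n + L * n : ℕ) : ℝ) ^ (1 - b) ≤
        (triangleCount (blowUp L hn hm1 G) : ℝ) :=
      (threshold_le hb₀ hb₁ hκ hn hL).trans (by exact_mod_cast hcount)
    have hpos : 0 < triangleCount (blowUp L hn hm1 G) := by
      have hN0 : (0 : ℝ) < ((L * n + L * n + L * n : ℕ) : ℝ) := by exact_mod_cast hN1
      have : (0 : ℝ) < (triangleCount (blowUp L hn hm1 G) : ℝ) :=
        (mul_pos hκ (Real.rpow_pos_of_pos hN0 _)).trans_le hthr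
      exact_mod_cast this
    obtain ⟨k, hkT, hk⟩ := hmany hthr
    have hdet : DetectsTriangle G = fun mem => mem 0 = 1 := by
      funext mem
      simp [DetectsTriangle, hG3]
    rw [hdet]
    refine hk.trans (key _ 1 k (fun mem h => h.verdict_of_pos hε₁ hpos) (.inr ?_))
    have hkT' : (k : ℝ) ≤ T := by
      refine hkT.trans ?_
      have hN1' : (1 : ℝ) ≤ ((L * n + L * n + L * n : ℕ) : ℝ) := by exact_mod_cast hN1
      calc K * MM F (L * n + L * n + L * n) 1 b 1 ^ (1 - δ)
          ≤ |K| * ((L * n + L * n + L * n : ℕ) : ℝ) ^ (β : ℝ) := by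
            rw [MM_rpow]
            gcongr
            · exact le_abs_self K
        _ = |K| * (L + L + L : ℝ) ^ (β : ℝ) * (n : ℝ) ^ (β : ℝ) := by
            rw [mul_assoc, ← Real.mul_rpow (by positivity) (by positivity)]
            push_cast; ring_nf
        _ ≤ |K| * (L + L + L : ℝ) ^ (β : ℝ) * (2 * 2 ^ (p * bitLength n / q)) := by
            gcongr
            rw [← hpq]
            exact rpow_le_two_mul_two_pow hq n
        _ = |K| * (L + L + L : ℝ) ^ (β : ℝ) * 2 * 2 ^ (p * bitLength n / q) := by ring
        _ ≤ C * 2 ^ (p * bitLength n / q) := by gcongr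
        _ = (T : ℝ) := by rw [hTeq]; push_cast; rfl
    exact_mod_cast hkT'

theorem mainTheorem3 {F : Type*} [Field F] (b : ℝ) (hb₀ : 0 ≤ b) (hb₁ : b ≤ 1)
    (hyp : UnbalancedTriangleHypothesis F b)
    (ε : ℝ) (hε₀ : 0 < ε) (hε₁ : ε < 1) (κ : ℝ) (hκ : 0 < κ) :
    ∀ δ : ℝ, 0 < δ → ¬ ∃ (P : RAMProgram) (K : ℝ),
      ApproximatesTriangles P ε (fun n => κ * (n : ℝ) ^ (1 - b))
        (fun n => K * (MM F n 1 b 1) ^ (1 - δ)) := by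
  rintro δ hδ ⟨P, K, hP⟩
  -- Half of the minimum gives a saving strictly below both `δ` and 1: the first leaves room for the
  -- rational exponent, the second keeps the target exponent positive.
  have h1 : min δ 1 / 2 < δ := by have := min_le_left δ 1; linarith
  have h2 : min δ 1 / 2 < 1 := by have := min_le_right δ 1; linarith
  have h3 : 0 < min δ 1 / 2 := half_pos (lt_min hδ one_pos)
  exact hyp _ h3 (exists_detector hb₀ hb₁ hε₁ hκ h3 h1 h2 hP)
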